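/- Let $M$ be a smooth (Hausdorff, paracompact) $N$-dimensional manifold and let $G$ be a connected compact Lie group. A *curve* in $M$ is a piecewise smooth map $c:[a,b]\to M$, $a<b$, that is an immersion on each (closed) piece. Two curves are *equivalent* if one is the composition of the other with a positive (orientation preserving) diffeomorphism between their domains. The product of two curves, one of which ends where the other begins, is obtained by gluing them at this common point, and the inverse of a curve is its reparametrization by an order-reversing diffeomorphism; both are defined up to equivalence. A *family* is a finite set of curves with a chosen ordering $c_1,\dots,c_n$; its range is the union of the ranges of the $c_i$. A family $C$ *depends* on a collection $D$ of curves if every curve in $C$ is equivalent to a finite product of curves in $D$ and inverses of curves in $D$. A point $p$ in the range of a family is *regular* if it is not the image of an endpoint or of a point of nondifferentiability of any curve of the family, and some neighborhood of $p$ meets the range of the family in an embedded (open) interval. The *type* of a regular point $p$ is the subgroup of $G^n$ of all $(g_1,\dots,g_n)$ such that for some $g\in G$, $g_i=g$ if $p$ lies on $c_i$ and $g_i=1$ otherwise. A family $T=\{c_1,\dots,c_n\}$ is a *tassel based on* $p\in\mathrm{range}(T)$ if: (a) $\mathrm{range}(T)$ lies in a contractible open subset of $M$; (b) the curves of $T$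 can be replaced by equivalent curves such that $c_i(t)=c_j(s)$ implies $t=s$ (for all $i,j$), and such that every $c_i$ has left endpoint $0$ with $c_i(0)=p$; (c) any two curves of $T$ that intersect at a point other than $p$ intersect at a point other than $p$ in every neighborhood of $p$; (d) any type that occurs at some regular point of $T$ occurs at some regular point of $T$ in every neighborhood of $p$. A collection of families $C^1,\dots,C^k$ is *independent* if, for $i\ne j$, any curve in $C^i$ meets any curve in $C^j$, if at all, only at their endpoints, and each such intersection point has a neighborhood whose intersection with $\mathrm{range}(C^i\cup C^j)$ is an embedded interval. A *web* is a finite independent collection of tassels $W^1,\dots,W^k$ such that no tassel contains the base of another. **Proposition.** For every family of curves $C$ in $M$ there is a web $W^1,\dots,W^k$ in $M$ such that $C$ depends on $W^1\cup\dots\cup W^k$; that is, every curve in $C$ is equivalent to a finite product of curves of the web and their inverses. -/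

import Mathlib

open Set Topology
open scoped Manifold ContDiff

namespace SmoothWebs

section Intervals

variable {N : ℕ} {M : Type*} [TopologicalSpace M] [ChartedSpace (EuclideanSpace ℝ (Fin N)) M]

/-- `f` is a smooth immersion on the set `s` (used for `s` a closed interval of positive length;
smoothness and the derivative at the endpoints are one-sided). -/
def SmoothImmersionOn (N : ℕ) {M : Type*} [TopologicalSpace M]
    [ChartedSpace (EuclideanSpace ℝ (Fin N)) M] (f : ℝ → M) (s : Set ℝ) : Prop :=
  ContMDiffOn 𝓘(ℝ, ℝ) (𝓡 N) ∞ f s ∧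
    ∀ t ∈ s, Function.Injective (mfderivWithin 𝓘(ℝ, ℝ) (𝓡 N) f s t)

/-- `S` is an embedded (open) interval: the image of an open interval under a smooth embedding. -/
def IsEmbeddedInterval (N : ℕ) {M : Type*} [TopologicalSpace M]
    [ChartedSpace (EuclideanSpace ℝ (Fin N)) M] (S : Set M) : Prop :=
  ∃ (a b : ℝ) (γ : ℝ → M), a < b ∧ SmoothImmersionOn N γ (Ioo a b) ∧
    IsEmbedding ((Ioo a b).domRestrict γ) ∧ S = γ '' Ioo a b

/-- The map `f` on `[a, b]` is the composition of the map `g` on `[c, d]` with a positive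
(that is, orientation preserving) diffeomorphism `[a, b] → [c, d]`. -/
def PosReparam {M : Type*} (f : ℝ → M) (a b : ℝ) (g : ℝ → M) (c d : ℝ) : Prop :=
  ∃ φ : ℝ → ℝ, ContDiffOn ℝ ∞ φ (Icc a b) ∧ (∀ t ∈ Icc a b, 0 < derivWithin φ (Icc a b) t) ∧
    φ a = c ∧ φ b = d ∧ ∀ t ∈ Icc a b, f t = g (φ t)

/-- The map `f` on `[a, b]` is the composition of the map `g` on `[c, d]` with an order-reversing
diffeomorphism `[a, b] → [c, d]`. -/
def NegReparam {M : Type*} (f : ℝ → M) (a b : ℝ) (g : ℝ → M) (c d : ℝ) : Prop :=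
  ∃ φ : ℝ → ℝ, ContDiffOn ℝ ∞ φ (Icc a b) ∧ (∀ t ∈ Icc a b, derivWithin φ (Icc a b) t < 0) ∧
    φ a = d ∧ φ b = c ∧ ∀ t ∈ Icc a b, f t = g (φ t)

end Intervals

/-- A curve: a piecewise smooth map from a closed interval `[a, b]` to `M` that is an immersion on
each (closed) piece. The values of `toFun` outside `[a, b]` are irrelevant. Continuity on `[a, b]`
is implied, as consecutive closed pieces share a point. -/
structure Curve (N : ℕ) (M : Type*) [TopologicalSpace M]
    [ChartedSpace (EuclideanSpace ℝ (Fin N)) M] where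
  /-- left endpoint of the domain -/
  a : ℝ
  /-- right endpoint of the domain -/
  b : ℝ
  a_lt_b : a < b
  /-- the map -/
  toFun : ℝ → M
  piecewise : ∃ (n : ℕ) (τ : Fin (n + 1) → ℝ), StrictMono τ ∧ τ 0 = a ∧ τ (Fin.last n) = b ∧
    ∀ k : Fin n, SmoothImmersionOn N toFun (Icc (τ k.castSucc) (τ k.succ))

section Curves

variable {N : ℕ} {M : Type*} [TopologicalSpace M] [ChartedSpace (EuclideanSpace ℝ (Fin N)) M]

/-- The domain of a curve. -/
def Curve.dom (c : Curve N M) : Set ℝ := Icc c.a c.b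

/-- The range of a curve. -/
def Curve.range (c : Curve N M) : Set M := c.toFun '' c.dom

/-- Two curves are the same map with the same domain. -/
def Curve.Same (c c' : Curve N M) : Prop :=
  c.a = c'.a ∧ c.b = c'.b ∧ EqOn c.toFun c'.toFun c.dom

/-- Equivalence of curves: reparametrization by a positive diffeomorphism. -/
def Curve.Equivalent (c c' : Curve N M) : Prop :=
  PosReparam c.toFun c.a c.b c'.toFun c'.a c'.b

/-- `IsProductOf D f a b`: up to equivalence, the map `f` on `[a, b]` is a finite (nonempty)
product of curves in `D` and inverses of curves in `D`. Here `f` on `[a, b]` is a product if, at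
some intermediate time `t`, it is the gluing of its restrictions to `[a, t]` and `[t, b]`, each
of which is a product. -/
inductive IsProductOf (D : Set (Curve N M)) (f : ℝ → M) : ℝ → ℝ → Prop
  | curve {a b : ℝ} (d : Curve N M) (hd : d ∈ D) (h : PosReparam f a b d.toFun d.a d.b) :
      IsProductOf D f a b
  | inverse {a b : ℝ} (d : Curve N M) (hd : d ∈ D) (h : NegReparam f a b d.toFun d.a d.b) :
      IsProductOf D f a b
  | mul {a t b : ℝ} (hat : a < t) (htb : t < b) (h₁ : IsProductOf D f a t)
      (h₂ : IsProductOf D f t b) : IsProductOf D f a b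

end Curves

/-- A family: a finite set of curves with a chosen ordering. -/
structure CurveFamily (N : ℕ) (M : Type*) [TopologicalSpace M]
    [ChartedSpace (EuclideanSpace ℝ (Fin N)) M] where
  /-- the number of curves -/
  card : ℕ
  /-- the curves in their order -/
  curve : Fin card → Curve N M
  distinct : ∀ i j, (curve i).Same (curve j) → i = j

section Families

variable {N : ℕ} {M : Type*} [TopologicalSpace M] [ChartedSpace (EuclideanSpace ℝ (Fin N)) M]

/-- The union of the ranges of the curves of a family. -/
def CurveFamily.range (C : CurveFamily N M) : Set M := ⋃ i, (C.curve i).range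

/-- A family depends on a collection of curves if each of its curves is equivalent to a finite
product of curves of the collection and their inverses. -/
def CurveFamily.DependsOn (C : CurveFamily N M) (D : Set (Curve N M)) : Prop :=
  ∀ i, IsProductOf D (C.curve i).toFun (C.curve i).a (C.curve i).b

/-- A collection of families is independent if curves in different families intersect only at
endpoints of both, and each such intersection point has a neighborhood whose intersection with
the union of the ranges of the two families is an embedded interval. -/
def IndependentFamilies {k : ℕ} (W : Fin k → CurveFamily N M) : Prop :=
  ∀ α β, α ≠ β → ∀ i j, ∀ s ∈ ((W α).curve i).dom, ∀ t ∈ ((W β).curve j).dom,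
    ((W α).curve i).toFun s = ((W β).curve j).toFun t →
      (s = ((W α).curve i).a ∨ s = ((W α).curve i).b) ∧
      (t = ((W β).curve j).a ∨ t = ((W β).curve j).b) ∧
      ∃ U ∈ 𝓝 (((W α).curve i).toFun s),
        IsEmbeddedInterval N (U ∩ ((W α).range ∪ (W β).range))

/-- Regular points of a family: points of the range which are not the image of an endpoint or a
point of nondifferentiability and near which the range is an embedded interval. -/
def CurveFamily.IsRegularPoint (C : CurveFamily N M) (p : M) : Prop :=
  p ∈ C.range ∧
  (∀ i, ∀ t ∈ (C.curve i).dom, (C.curve i).toFun t = p →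
    t ≠ (C.curve i).a ∧ t ≠ (C.curve i).b ∧
      MDifferentiableAt 𝓘(ℝ, ℝ) (𝓡 N) (C.curve i).toFun t) ∧
  ∃ U ∈ 𝓝 p, IsEmbeddedInterval N (U ∩ C.range)

/-- A consistent parametrization: a point is only ever reached at one parameter value. -/
def ConsistentlyParametrized {n : ℕ} (S : Fin n → Curve N M) : Prop :=
  ∀ i j, ∀ s ∈ (S i).dom, ∀ t ∈ (S j).dom, (S i).toFun s = (S j).toFun t → s = t

/-- The type of a point `p`: the subgroup of `G ^ n` of all tuples having one common entry `g` at
the indices of the curves through `p` and entry `1` at all other indices. -/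
def CurveFamily.typeAt (G : Type*) [Group G] (C : CurveFamily N M) (p : M) :
    Subgroup (Fin C.card → G) where
  carrier := {x | ∃ g : G, ∀ i,
    (p ∈ (C.curve i).range → x i = g) ∧ (p ∉ (C.curve i).range → x i = 1)}
  one_mem' := ⟨1, fun _ => ⟨fun _ => rfl, fun _ => rfl⟩⟩
  mul_mem' := by
    rintro x y ⟨g, hg⟩ ⟨h, hh⟩
    refine ⟨g * h, fun i => ⟨fun hi => ?_, fun hi => ?_⟩⟩
    · simp [(hg i).1 hi, (hh i).1 hi]
    · simp [(hg i).2 hi, (hh i).2 hi]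
  inv_mem' := by
    rintro x ⟨g, hg⟩
    refine ⟨g⁻¹, fun i => ⟨fun hi => ?_, fun hi => ?_⟩⟩
    · simp [(hg i).1 hi]
    · simp [(hg i).2 hi]

/-- The family `T` is a tassel based on `p`. -/
structure CurveFamily.IsTassel (G : Type*) [Group G] (T : CurveFamily N M) (p : M) : Prop where
  base_mem : p ∈ T.range
  contractible : ∃ O : Set M, IsOpen O ∧ ContractibleSpace O ∧ T.range ⊆ O
  parametrization : ∃ S : Fin T.card → Curve N M, (∀ i, (S i).Equivalent (T.curve i)) ∧
    ConsistentlyParametrized S ∧ ∀ i, (S i).a = 0 ∧ (S i).toFun 0 = p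
  intersect : ∀ i j, i ≠ j → (∃ q, q ≠ p ∧ q ∈ (T.curve i).range ∧ q ∈ (T.curve j).range) →
    ∀ U ∈ 𝓝 p, ∃ q ∈ U, q ≠ p ∧ q ∈ (T.curve i).range ∧ q ∈ (T.curve j).range
  types : ∀ q, T.IsRegularPoint q → ∀ U ∈ 𝓝 p, ∃ q' ∈ U, T.IsRegularPoint q' ∧
    T.typeAt G q' = T.typeAt G q

end Families

/-- A web: a finite independent collection of tassels, none of which contains the base of
another. -/
structure Web (G : Type*) [Group G] (N : ℕ) (M : Type*) [TopologicalSpace M]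
    [ChartedSpace (EuclideanSpace ℝ (Fin N)) M] where
  /-- the number of tassels -/
  card : ℕ
  /-- the tassels -/
  tassel : Fin card → CurveFamily N M
  /-- their bases -/
  base : Fin card → M
  isTassel : ∀ α, (tassel α).IsTassel G (base α)
  independent : IndependentFamilies tassel
  base_notMem : ∀ α β, α ≠ β → base α ∉ (tassel β).range

/-- The set of all curves of all tassels of a web. -/
def Web.curves {G : Type*} [Group G] {N : ℕ} {M : Type*} [TopologicalSpace M]
    [ChartedSpace (EuclideanSpace ℝ (Fin N)) M] (W : Web G N M) : Set (Curve N M) :=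
  {c | ∃ α i, (W.tassel α).curve i = c}

end SmoothWebs

/-! Cut the curves into finitely many smoothly immersed arcs. Near any point `p` there is a height:
a linear functional of a chart that has nonzero derivative along every arc
(`ArcSystem.exists_isHeight`). Every arc is strictly monotone in the height, so it can be
parametrized by it.

Call a point nice if, near it, the union of the arcs is mapped injectively by every height and
contains no arc endpoint; the arcs through it then locally coincide as sets. The failures of
niceness along one arc form a meagre set: they come from endpoints and from frontiers of countably
many closed coincidence sets (`ArcSystem.isMeagre_not_isNice`). Hence nice levels, those containing
only nice points, are dense (`IsHeight.dense_nice_levels`), and a compact part of the arcs meets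
each level in finitely many points.

A sufficiently small neighborhood of `p`, cut down to a slab between two levels, is a cell. Its arcs
run from `p` to one of the bounding levels. Only finitely many germs of arcs issue from `p`, so the
neighborhood can be taken so small that every combination of germs occurring in it occurs
arbitrarily close to `p` (`ArcSystem.exists_cell`). This yields both recurrence conditions of a
tassel, since the type of a point depends only on which curves pass through it.

It remains to cover the arcs by finitely many disjoint cells, up to finitely many nice points. Where
a single height is available, slabs around each level are put together at nice levels
(`IsHeight.isWebbable`); then finitely many open sets whose frontiers meet the arcs in nice points
are added one at a time (`ArcSystem.isWebbable_univ`).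

The half arcs of each cell, parametrized by the distance in height from its base, form a tassel
(`IsCell.exists_tassel`). Tassels of different cells meet only at leftover nice points, where two
disjoint half arcs must approach from opposite sides and together fill an embedded interval
(`ArcSystem.IsNice.eventually_mem_of_disjoint`). Each original arc breaks into half arcs at the
bases and the leftover points. -/

namespace SmoothWebs

/-! ### Calculus, category and finite subdivision on the real line -/

section RealLine

open Filter

/-- Darboux's theorem gives the derivative a constant sign without assuming that it is continuous.
-/
theorem strictMonoOn_or_strictAntiOn_of_derivWithin_ne_zero {f : ℝ → ℝ} {u v : ℝ}
    (hf : ∀ t ∈ Icc u v, DifferentiableWithinAt ℝ f (Icc u v) t)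
    (hd : ∀ t ∈ Icc u v, derivWithin f (Icc u v) t ≠ 0) :
    (StrictMonoOn f (Icc u v) ∧ ∀ t ∈ Icc u v, 0 < derivWithin f (Icc u v) t) ∨
      (StrictAntiOn f (Icc u v) ∧ ∀ t ∈ Icc u v, derivWithin f (Icc u v) t < 0) := by
  have hc : ContinuousOn f (Icc u v) := fun t ht => (hf t ht).continuousWithinAt
  have hderiv : ∀ t ∈ interior (Icc u v), deriv f t = derivWithin f (Icc u v) t := fun t ht =>
    (derivWithin_of_mem_nhds (mem_interior_iff_mem_nhds.1 ht)).symm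
  rcases hasDerivWithinAt_forall_lt_or_forall_gt_of_forall_ne (convex_Icc u v)
    (fun t ht => (hf t ht).hasDerivWithinAt) hd with h | h
  · exact .inr ⟨strictAntiOn_of_deriv_neg (convex_Icc u v) hc fun t ht => by
      rw [hderiv t ht]; exact h t (interior_subset ht), h⟩
  · exact .inl ⟨strictMonoOn_of_deriv_pos (convex_Icc u v) hc fun t ht => by
      rw [hderiv t ht]; exact h t (interior_subset ht), h⟩

theorem finite_of_isCompact_of_isolated {X : Type*} [TopologicalSpace X] {K : Set X}
    (hK : IsCompact K) (h : ∀ t ∈ K, ∃ U ∈ 𝓝 t, ∀ x ∈ U, x ∈ K → x = t) : K.Finite := by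
  choose! U hU hU' using h
  obtain ⟨F, hF, hKF⟩ := hK.elim_nhds_subcover U hU
  refine F.finite_toSet.subset fun x hx => ?_
  obtain ⟨t, ht, hxt⟩ := mem_iUnion₂.1 (hKF hx)
  rw [hU' t (hF t ht) x hxt hx]
  exact ht

/-- Smoothness is needed up to the endpoints, where derivatives are one-sided. Compactness makes the
inverse continuous, a left-inverse argument gives its derivative, and the formula for that
derivative is then bootstrapped. -/
theorem exists_contDiffOn_inverse {φ : ℝ → ℝ} {u v c d : ℝ} (hcd : c < d)
    (hφ : ContDiffOn ℝ ∞ φ (Icc u v)) (hd : ∀ t ∈ Icc u v, derivWithin φ (Icc u v) t ≠ 0)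
    (hinj : InjOn φ (Icc u v)) (himg : φ '' Icc u v = Icc c d) :
    ∃ ψ : ℝ → ℝ, ContDiffOn ℝ ∞ ψ (Icc c d) ∧ MapsTo ψ (Icc c d) (Icc u v) ∧
      (∀ t ∈ Icc u v, ψ (φ t) = t) ∧ (∀ r ∈ Icc c d, φ (ψ r) = r) ∧
      ∀ r ∈ Icc c d, derivWithin ψ (Icc c d) r ≠ 0 := by
  have huv : u < v := by
    by_contra! h
    have hs : (φ '' Icc u v).Subsingleton := (subsingleton_Icc_of_ge h).image φ
    rw [himg] at hs
    exact hcd.ne (hs (left_mem_Icc.2 hcd.le) (right_mem_Icc.2 hcd.le))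
  set ψ := Function.invFunOn φ (Icc u v)
  have hmaps : MapsTo ψ (Icc c d) (Icc u v) := fun r hr =>
    Function.invFunOn_mem (by rwa [← himg] at hr)
  have hright : ∀ r ∈ Icc c d, φ (ψ r) = r := fun r hr =>
    Function.invFunOn_eq (by rwa [← himg] at hr)
  have hleft : ∀ t ∈ Icc u v, ψ (φ t) = t := fun t ht =>
    hinj (hmaps (himg ▸ mem_image_of_mem φ ht)) ht (hright _ (himg ▸ mem_image_of_mem φ ht))
  have hcont : ContinuousOn ψ (Icc c d) := by
    rw [continuousOn_iff_isClosed]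
    intro K hK
    refine ⟨φ '' (Icc u v ∩ K), ((isCompact_Icc.inter_right hK).image_of_continuousOn
      (hφ.continuousOn.mono inter_subset_left)).isClosed, ?_⟩
    ext r
    constructor
    · rintro ⟨hr, hrc⟩
      exact ⟨⟨ψ r, ⟨hmaps hrc, hr⟩, hright r hrc⟩, hrc⟩
    · rintro ⟨⟨t, ⟨ht, htK⟩, rfl⟩, hrc⟩
      exact ⟨by rw [mem_preimage, hleft t ht]; exact htK, hrc⟩
  have hderiv : ∀ r ∈ Icc c d,
      HasDerivWithinAt ψ (derivWithin φ (Icc u v) (ψ r))⁻¹ (Icc c d) r := by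
    intro r hr
    have h1 := ((hφ.differentiableOn (by simp)) _ (hmaps hr)).hasDerivWithinAt.hasFDerivWithinAt
    rw [show ContinuousLinearMap.toSpanSingleton ℝ (derivWithin φ (Icc u v) (ψ r)) =
        ((ContinuousLinearEquiv.unitsEquivAut ℝ (Units.mk0 _ (hd _ (hmaps hr))) : ℝ ≃L[ℝ] ℝ) :
          ℝ →L[ℝ] ℝ) by ext; simp] at h1
    have h2 := HasFDerivWithinAt.of_local_left_inverse (g := ψ) (a := r) (s := Icc c d)
      ((hcont r hr).tendsto_nhdsWithin hmaps) h1 hr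
      (eventually_mem_nhdsWithin.mono fun x hx => hright x hx)
    have h3 := h2.hasDerivWithinAt
    simpa using h3
  have hdW : ∀ r ∈ Icc c d, derivWithin ψ (Icc c d) r = (derivWithin φ (Icc u v) (ψ r))⁻¹ :=
    fun r hr => (hderiv r hr).derivWithin (uniqueDiffOn_Icc hcd r hr)
  have hφ' : ContDiffOn ℝ ∞ (derivWithin φ (Icc u v)) (Icc u v) :=
    ((contDiffOn_infty_iff_derivWithin (uniqueDiffOn_Icc huv)).1 hφ).2
  -- Since ψ' = 1 / (φ' ∘ ψ), each order of smoothness of ψ gives the next.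
  have hn : ∀ n : ℕ, ContDiffOn ℝ n ψ (Icc c d) := by
    intro n
    induction n with
    | zero => exact_mod_cast contDiffOn_zero.2 hcont
    | succ n ih =>
      push_cast
      rw [contDiffOn_succ_iff_derivWithin (uniqueDiffOn_Icc hcd)]
      refine ⟨fun r hr => (hderiv r hr).differentiableWithinAt, by simp, ?_⟩
      refine ContDiffOn.congr (f := fun r => (derivWithin φ (Icc u v) (ψ r))⁻¹) ?_ hdW
      exact ((hφ'.of_le (by exact_mod_cast le_top)).comp ih hmaps).inv
        fun r hr => hd _ (hmaps hr)
  exact ⟨ψ, contDiffOn_infty.2 hn, hmaps, hleft, hright, fun r hr => by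
    rw [hdW r hr]; exact inv_ne_zero (hd _ (hmaps hr))⟩

/-- Compactness sends closed pieces to closed sets. If the image of a closed nowhere dense piece had
interior, continuity and injectivity would pull that interior back to the piece. -/
theorem isMeagre_image_of_injOn {g : ℝ → ℝ} {u v : ℝ} (hg : ContinuousOn g (Icc u v))
    (hinj : InjOn g (Icc u v)) {B : Set ℝ} (hB : IsMeagre B) :
    IsMeagre (g '' (B ∩ Icc u v)) := by
  obtain ⟨S, hS, hSc, hBS⟩ := isMeagre_iff_countable_union_isNowhereDense.1 hB
  refine IsMeagre.mono (s := ⋃ F ∈ S, g '' (closure F ∩ Icc u v)) ?_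
    (isMeagre_biUnion hSc fun F hF => ?_)
  · rintro _ ⟨t, ⟨ht, htI⟩, rfl⟩
    obtain ⟨F, hF, htF⟩ := hBS ht
    exact mem_iUnion₂.2 ⟨F, hF, mem_image_of_mem g ⟨subset_closure htF, htI⟩⟩
  · refine IsNowhereDense.isMeagre ?_
    have hcl : IsClosed (g '' (closure F ∩ Icc u v)) :=
      ((isCompact_Icc.inter_left isClosed_closure).image_of_continuousOn
        (hg.mono inter_subset_right)).isClosed
    rw [hcl.isNowhereDense_iff]
    by_contra hne
    obtain ⟨y, hy⟩ := nonempty_iff_ne_empty.2 hne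
    have hinf : (interior (g '' (closure F ∩ Icc u v))).Infinite :=
      infinite_of_mem_nhds y (isOpen_interior.mem_nhds hy)
    obtain ⟨z, hz, hzn⟩ := hinf.exists_notMem_finite (toFinite {g u, g v})
    obtain ⟨w, ⟨hwF, hw⟩, rfl⟩ := interior_subset hz
    have hwI : w ∈ Ioo u v := by
      refine ⟨lt_of_le_of_ne hw.1 ?_, lt_of_le_of_ne hw.2 ?_⟩ <;> rintro rfl <;> simp at hzn
    have hmem : closure F ∈ 𝓝 w := by
      have hn : Icc u v ∈ 𝓝 w := Icc_mem_nhds hwI.1 hwI.2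
      filter_upwards [hn, (hg.continuousAt hn).preimage_mem_nhds
        (isOpen_interior.mem_nhds hz)] with w' hw' hw''
      obtain ⟨w₂, ⟨h2, h2'⟩, h3⟩ := interior_subset hw''
      rwa [← hinj h2' hw' h3]
    have : w ∈ interior (closure F) := mem_interior_iff_mem_nhds.2 hmem
    rw [hS F hF] at this
    exact this

/-- A finitely additive property of intervals with endpoints in a dense set that holds for small
intervals around every point of `[m, m']` holds for some interval around `[m, m']`. -/
theorem exists_interval_of_locally {G : Set ℝ} (hG : Dense G) {R : ℝ → ℝ → Prop}
    (htrans : ∀ x ∈ G, ∀ y ∈ G, ∀ z ∈ G, x < y → y < z → R x y → R y z → R x z)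
    (hloc : ∀ x, ∃ δ > 0, ∀ s ∈ G, ∀ s' ∈ G, s ∈ Ioo (x - δ) x → s' ∈ Ioo x (x + δ) → R s s')
    {m m' : ℝ} (hm : m ≤ m') : ∃ s s', s < m ∧ m' < s' ∧ R s s' := by
  choose δ hδ hR using hloc
  obtain ⟨s₀, hs₀, hs₀l, hs₀r⟩ := hG.exists_between (show m - δ m < m by linarith [hδ m])
  -- The points just short of which a chain of intervals from s₀ has arrived; its supremum is shown
  -- to be m'. The case s = s₀ is the empty chain, as R s₀ s₀ is not available.
  let S : Set ℝ := {x | x ∈ Icc m m' ∧ ∃ s ∈ G, s ∈ Ioo (x - δ x) x ∧ (s = s₀ ∨ s₀ < s ∧ R s₀ s)}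
  have key : ∀ x ∈ S, ∀ s' ∈ G, s' ∈ Ioo x (x + δ x) → s₀ < s' ∧ R s₀ s' := by
    rintro x ⟨hx, s, hsG, hs, rfl | ⟨hs0, hsR⟩⟩ s' hs'G hs'
    · exact ⟨hs.2.trans hs'.1, hR x _ hs₀ _ hs'G hs hs'⟩
    · exact ⟨hs0.trans (hs.2.trans hs'.1), htrans _ hs₀ _ hsG _ hs'G hs0 (hs.2.trans hs'.1) hsR
        (hR x _ hsG _ hs'G hs hs')⟩
  have hmS : m ∈ S := ⟨left_mem_Icc.2 hm, s₀, hs₀, ⟨hs₀l, hs₀r⟩, .inl rfl⟩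
  have hbdd : BddAbove S := ⟨m', fun x hx => hx.1.2⟩
  set y := sSup S
  have hmy : m ≤ y := le_csSup hbdd hmS
  have hym : y ≤ m' := csSup_le ⟨m, hmS⟩ fun x hx => hx.1.2
  have hyS : y ∈ S := by
    obtain ⟨x, hxS, hx⟩ := exists_lt_of_lt_csSup ⟨m, hmS⟩ (show y - δ y < y by linarith [hδ y])
    rcases (le_csSup hbdd hxS).eq_or_lt with h | h
    · rwa [← show x = y from h]
    · obtain ⟨s', hs'G, hs'l, hs'r⟩ := hG.exists_between
        (show x < min (x + δ x) y from lt_min (by linarith [hδ x]) h)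
      exact ⟨⟨hmy, hym⟩, s', hs'G, ⟨hx.trans hs'l, hs'r.trans_le (min_le_right _ _)⟩,
        .inr (key x hxS s' hs'G ⟨hs'l, hs'r.trans_le (min_le_left _ _)⟩)⟩
  have hy' : y = m' := by
    by_contra hne
    have hlt : y < m' := lt_of_le_of_ne hym hne
    obtain ⟨z, hyz, hz⟩ := exists_between (show y < min (y + δ y) m' from
      lt_min (by linarith [hδ y]) hlt)
    obtain ⟨s', hs'G, hs'l, hs'r⟩ := hG.exists_between
      (show max y (z - δ z) < z from max_lt hyz (by linarith [hδ z]))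
    have hzS : z ∈ S := ⟨⟨hmy.trans hyz.le, (hz.trans_le (min_le_right _ _)).le⟩, s', hs'G,
      ⟨(le_max_right _ _).trans_lt hs'l, hs'r⟩, .inr (key y hyS s' hs'G
        ⟨(le_max_left _ _).trans_lt hs'l, hs'r.trans (hz.trans_le (min_le_left _ _))⟩)⟩
    exact absurd (le_csSup hbdd hzS) (not_le.2 hyz)
  obtain ⟨s', hs'G, hs'l, hs'r⟩ := hG.exists_between (show y < y + δ y by linarith [hδ y])
  exact ⟨s₀, s', hs₀r, hy' ▸ hs'l, (key y hyS s' hs'G ⟨hs'l, hs'r⟩).2⟩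

/-- An additive property of intervals that holds between consecutive points of a finite set holds
between any two points of the set. -/
theorem interval_of_consecutive {E : Set ℝ} (hE : E.Finite) {P : ℝ → ℝ → Prop}
    (htrans : ∀ x y z, x < y → y < z → P x y → P y z → P x z)
    (hcons : ∀ x ∈ E, ∀ y ∈ E, x < y → (∀ z ∈ Ioo x y, z ∉ E) → P x y) :
    ∀ x ∈ E, ∀ y ∈ E, x < y → P x y := by
  suffices h : ∀ n, ∀ x ∈ E, ∀ y ∈ E, x < y → (E ∩ Ioo x y).ncard = n → P x y from
    fun x hx y hy hxy => h _ x hx y hy hxy rfl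
  intro n
  induction n using Nat.strong_induction_on with
  | _ n ih =>
    intro x hx y hy hxy hn
    by_cases h : ∀ z ∈ Ioo x y, z ∉ E
    · exact hcons x hx y hy hxy h
    · push Not at h
      obtain ⟨z, hz, hzE⟩ := h
      have hfin : (E ∩ Ioo x y).Finite := hE.subset inter_subset_left
      have h1 : (E ∩ Ioo x z).ncard < n := hn ▸ ncard_lt_ncard (ssubset_iff_exists.2
        ⟨inter_subset_inter_right _ (Ioo_subset_Ioo_right hz.2.le), z, ⟨hzE, hz⟩, by simp⟩) hfin
      have h2 : (E ∩ Ioo z y).ncard < n := hn ▸ ncard_lt_ncard (ssubset_iff_exists.2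
        ⟨inter_subset_inter_right _ (Ioo_subset_Ioo_left hz.1.le), z, ⟨hzE, hz⟩, by simp⟩) hfin
      exact htrans x z y hz.1 hz.2 (ih _ h1 x hx z hzE hz.1 rfl) (ih _ h2 z hzE y hy hz.2 rfl)

theorem exists_next_of_finite {E : Set ℝ} (hE : E.Finite) {x b : ℝ} (hb : b ∈ E) (hxb : x < b) :
    ∃ v ∈ E, x < v ∧ ∀ z ∈ Ioo x v, z ∉ E := by
  obtain ⟨v, hv, hmin⟩ := exists_min_image (E ∩ Ioi x) id (hE.subset inter_subset_left)
    ⟨b, hb, hxb⟩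
  exact ⟨v, hv.1, hv.2, fun z hz hzE => not_lt.2 (hmin z ⟨hzE, hz.1⟩) hz.2⟩

theorem exists_prev_of_finite {E : Set ℝ} (hE : E.Finite) {x a : ℝ} (ha : a ∈ E) (hax : a < x) :
    ∃ u ∈ E, u < x ∧ ∀ z ∈ Ioo u x, z ∉ E := by
  obtain ⟨u, hu, hmax⟩ := exists_max_image (E ∩ Iio x) id (hE.subset inter_subset_left)
    ⟨a, ha, hax⟩
  exact ⟨u, hu.1, hu.2, fun z hz hzE => not_lt.2 (hmax z ⟨hzE, hz.2⟩) hz.1⟩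

/-- For finitely many predicates there is a neighbourhood in which only those hold somewhere that
hold arbitrarily close to the point. -/
theorem eventually_imp_frequently {X κ : Type*} [TopologicalSpace X] [Finite κ] (p : X)
    (P : κ → X → Prop) : ∀ᶠ x in 𝓝 p, ∀ k, P k x → ∃ᶠ y in 𝓝 p, P k y := by
  rw [eventually_all]
  intro k
  by_cases h : ∃ᶠ y in 𝓝 p, P k y
  · exact .of_forall fun _ _ => h
  · exact (not_frequently.1 h).mono fun x hx hPx => absurd hPx hx

end RealLine

/-! ### Arc systems and their height functions -/

section Heights

open Filter

/-- A finite collection of smoothly immersed arcs. -/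
structure ArcSystem (N : ℕ) (M : Type*) [TopologicalSpace M]
    [ChartedSpace (EuclideanSpace ℝ (Fin N)) M] where
  /-- the index type of the arcs -/
  ι : Type
  finite : Finite ι
  /-- the arcs -/
  c : ι → ℝ → M
  /-- left endpoints of the domains -/
  a : ι → ℝ
  /-- right endpoints of the domains -/
  b : ι → ℝ
  lt : ∀ i, a i < b i
  imm : ∀ i, SmoothImmersionOn N (c i) (Icc (a i) (b i))

variable {N : ℕ} {M : Type*} [TopologicalSpace M] [ChartedSpace (EuclideanSpace ℝ (Fin N)) M]

/-- The domain of an arc. -/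
abbrev ArcSystem.dom (A : ArcSystem N M) (i : A.ι) : Set ℝ := Icc (A.a i) (A.b i)

/-- The union of the ranges of the arcs. -/
def ArcSystem.carrier (A : ArcSystem N M) : Set M := ⋃ i, A.c i '' A.dom i

variable {A : ArcSystem N M}

theorem ArcSystem.mem_carrier {x : M} : x ∈ A.carrier ↔ ∃ i, ∃ t ∈ A.dom i, A.c i t = x := by
  simp [carrier]

theorem ArcSystem.apply_mem {i : A.ι} {t : ℝ} (ht : t ∈ A.dom i) : A.c i t ∈ A.carrier :=
  mem_carrier.2 ⟨i, t, ht, rfl⟩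

theorem ArcSystem.continuousOn (A : ArcSystem N M) (i : A.ι) : ContinuousOn (A.c i) (A.dom i) :=
  (A.imm i).1.continuousOn

theorem ArcSystem.isCompact_carrier (A : ArcSystem N M) : IsCompact A.carrier :=
  have := A.finite
  isCompact_iUnion fun i => isCompact_Icc.image_of_continuousOn (A.continuousOn i)

/-- The parameters outside the interior of W have compact image missing p, so points near p are
reached only at parameters in W. -/
theorem ArcSystem.eventually_mem_of_fiber [T2Space M] {p : M} {i : A.ι} {W : Set ℝ}
    (hW : ∀ t ∈ A.dom i, A.c i t = p → W ∈ 𝓝 t) :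
    ∀ᶠ x in 𝓝 p, ∀ t ∈ A.dom i, A.c i t = x → t ∈ W := by
  have hK : IsCompact (A.c i '' (A.dom i \ interior W)) :=
    (isCompact_Icc.diff isOpen_interior).image_of_continuousOn
      ((A.continuousOn i).mono sdiff_subset)
  have hp : p ∉ A.c i '' (A.dom i \ interior W) := by
    rintro ⟨t, ⟨ht, htW⟩, htp⟩
    exact htW (mem_interior_iff_mem_nhds.2 (hW t ht htp))
  filter_upwards [hK.isClosed.isOpen_compl.mem_nhds hp] with x hx t ht htx
  by_contra h
  exact hx ⟨t, ⟨ht, fun h' => h (interior_subset h')⟩, htx⟩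

/-- A height function for an arc system on an open set: one along which all arcs have nonzero
derivative. -/
structure IsHeight (A : ArcSystem N M) (D : Set M) (h : M → ℝ) : Prop where
  isOpen : IsOpen D
  contractible : ContractibleSpace D
  continuousOn : ContinuousOn h D
  contDiff : ∀ i, ∀ t ∈ A.dom i, A.c i t ∈ D → ContDiffWithinAt ℝ ∞ (h ∘ A.c i) (A.dom i) t
  deriv_ne : ∀ i, ∀ t ∈ A.dom i, A.c i t ∈ D → derivWithin (h ∘ A.c i) (A.dom i) t ≠ 0

theorem ArcSystem.contDiffWithinAt_chart [IsManifold (𝓡 N) ∞ M] {p : M} {i : A.ι} {t : ℝ}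
    (ht : t ∈ A.dom i) (hp : A.c i t ∈ (chartAt (EuclideanSpace ℝ (Fin N)) p).source) :
    ContDiffWithinAt ℝ ∞ (chartAt (EuclideanSpace ℝ (Fin N)) p ∘ A.c i) (A.dom i) t := by
  have h1 := (contMDiffAt_extChartAt' (I := 𝓡 N) (n := ∞) hp).comp_contMDiffWithinAt t
    ((A.imm i).1 t ht)
  have h2 := contMDiffWithinAt_iff_contDiffWithinAt.1 h1
  simpa [mfld_simps] using h2

theorem ArcSystem.derivWithin_chart_ne_zero [IsManifold (𝓡 N) ∞ M] {i : A.ι} {t : ℝ}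
    (ht : t ∈ A.dom i) :
    derivWithin (chartAt (EuclideanSpace ℝ (Fin N)) (A.c i t) ∘ A.c i) (A.dom i) t ≠ 0 := by
  intro h0
  have hinj := (A.imm i).2 t ht
  have hmd : MDifferentiableWithinAt 𝓘(ℝ, ℝ) (𝓡 N) (A.c i) (A.dom i) t :=
    ((A.imm i).1 t ht).mdifferentiableWithinAt (by simp)
  have h1 : mfderivWithin 𝓘(ℝ, ℝ) (𝓡 N) (A.c i) (A.dom i) t =
      fderivWithin ℝ (chartAt (EuclideanSpace ℝ (Fin N)) (A.c i t) ∘ A.c i) (A.dom i) t := by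
    refine hmd.mfderivWithin.trans ?_
    simp only [writtenInExtChartAt, mfld_simps]
    rfl
  rw [h1] at hinj
  have h2 : fderivWithin ℝ (chartAt (EuclideanSpace ℝ (Fin N)) (A.c i t) ∘ A.c i) (A.dom i) t
      (1 : ℝ) = 0 := h0
  have h3 := hinj (a₁ := (1 : ℝ)) (a₂ := (0 : ℝ)) (h2.trans (map_zero _).symm)
  exact one_ne_zero (α := ℝ) h3

/-- An immersion leaves its value at once, so the points of the compact fiber are isolated. -/
theorem ArcSystem.finite_fiber [T2Space M] [IsManifold (𝓡 N) ∞ M] (A : ArcSystem N M) (i : A.ι)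
    (p : M) : {t | t ∈ A.dom i ∧ A.c i t = p}.Finite := by
  have hcl : IsClosed (A.dom i ∩ A.c i ⁻¹' {p}) :=
    (A.continuousOn i).preimage_isClosed_of_isClosed isClosed_Icc isClosed_singleton
  refine finite_of_isCompact_of_isolated
    ((isCompact_Icc (a := A.a i) (b := A.b i)).of_isClosed_subset hcl inter_subset_left) ?_
  rintro t ⟨ht, rfl⟩
  have hd := (((A.contDiffWithinAt_chart ht (mem_chart_source _ _)).differentiableWithinAt
    (by simp)).hasDerivWithinAt).eventually_ne
      (c := chartAt (EuclideanSpace ℝ (Fin N)) (A.c i t) (A.c i t)) (derivWithin_chart_ne_zero ht)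
  rw [eventually_nhdsWithin_iff] at hd
  refine ⟨_, hd, fun x hx hx' => ?_⟩
  by_contra hne
  exact hx ⟨hx'.1, hne⟩ (by rw [Function.comp, hx'.2])

theorem ArcSystem.finite_fiber_sigma [T2Space M] [IsManifold (𝓡 N) ∞ M] (A : ArcSystem N M)
    (p : M) : Finite {x : Σ _ : A.ι, ℝ // x.2 ∈ A.dom x.1 ∧ A.c x.1 x.2 = p} := by
  have := A.finite
  have hU : {x : Σ _ : A.ι, ℝ | x.2 ∈ A.dom x.1 ∧ A.c x.1 x.2 = p} =
      ⋃ i, Sigma.mk i '' {t | t ∈ A.dom i ∧ A.c i t = p} := by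
    ext ⟨i, t⟩
    simp
  have hfin : {x : Σ _ : A.ι, ℝ | x.2 ∈ A.dom x.1 ∧ A.c x.1 x.2 = p}.Finite :=
    hU ▸ finite_iUnion fun i => (A.finite_fiber i p).image _
  exact hfin.to_subtype

/-- Finitely many passages through p have nonzero velocities in the chart, and some linear
functional vanishes on none of them. Continuity of the derivatives preserves this nearby; the domain
is taken to be the preimage of a chart ball in order to be contractible. -/
theorem ArcSystem.exists_isHeight [T2Space M] [IsManifold (𝓡 N) ∞ M] (A : ArcSystem N M) (p : M) :
    ∃ D h, IsHeight A D h ∧ p ∈ D := by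
  have := A.finite
  set e := chartAt (EuclideanSpace ℝ (Fin N)) p
  let κ := {x : Σ _ : A.ι, ℝ // x.2 ∈ A.dom x.1 ∧ A.c x.1 x.2 = p}
  have hκ : Finite κ := A.finite_fiber_sigma p
  obtain ⟨l, hl⟩ := Module.exists_dual_forall_apply_ne_zero (K := ℝ)
    (fun x : κ => derivWithin (e ∘ A.c x.1.1) (A.dom x.1.1) x.1.2) (by
      rintro ⟨⟨i, t⟩, ht, htp⟩
      have := A.derivWithin_chart_ne_zero ht
      rwa [htp] at this)
  let L := LinearMap.toContinuousLinearMap l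
  have hsmooth : ∀ i, ∀ t ∈ A.dom i, A.c i t ∈ e.source →
      ContDiffWithinAt ℝ ∞ ((L ∘ e) ∘ A.c i) (A.dom i) t := fun i t ht hp =>
    L.contDiff.comp_contDiffWithinAt (A.contDiffWithinAt_chart ht hp)
  have hW : ∀ i, ∀ᶠ x in 𝓝 p, ∀ t ∈ A.dom i, A.c i t = x →
      t ∈ {t | t ∈ A.dom i → derivWithin ((L ∘ e) ∘ A.c i) (A.dom i) t ≠ 0} := by
    intro i
    refine A.eventually_mem_of_fiber fun t ht htp => ?_
    have hs : A.c i t ∈ e.source := htp ▸ mem_chart_source _ p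
    have hu := uniqueDiffOn_Icc (A.lt i)
    have hc : ContinuousWithinAt (derivWithin ((L ∘ e) ∘ A.c i) (A.dom i)) (A.dom i) t := by
      have := ((hsmooth i t ht hs).fderivWithin_right hu (m := 0) (by simp) ht).continuousWithinAt
      have h2 := this.clm_apply (continuousWithinAt_const (b := (1 : ℝ)))
      exact h2
    have hne : derivWithin ((L ∘ e) ∘ A.c i) (A.dom i) t ≠ 0 := by
      have h1 := ((A.contDiffWithinAt_chart ht hs).differentiableWithinAt
        (by simp)).hasDerivWithinAt
      have h2 := L.hasFDerivAt.comp_hasDerivWithinAt t h1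
      rw [Function.comp_assoc, h2.derivWithin (hu t ht)]
      exact hl ⟨⟨i, t⟩, ht, htp⟩
    exact eventually_nhdsWithin_iff.1 (hc.eventually_ne hne)
  rw [← eventually_all] at hW
  have hep : e.target ∈ 𝓝 (e p) := e.open_target.mem_nhds (e.map_source (mem_chart_source _ p))
  have hW' : e '' (e.source ∩ {x | ∀ i, ∀ t ∈ A.dom i, A.c i t = x →
      t ∈ {t | t ∈ A.dom i → derivWithin ((L ∘ e) ∘ A.c i) (A.dom i) t ≠ 0}}) ∈ 𝓝 (e p) :=
    e.image_mem_nhds (mem_chart_source _ p)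
      (inter_mem (e.open_source.mem_nhds (mem_chart_source _ p)) hW)
  obtain ⟨r, hr, hball⟩ := Metric.mem_nhds_iff.1 (inter_mem hep hW')
  have hgood : ∀ x ∈ e.source ∩ e ⁻¹' Metric.ball (e p) r, ∀ i, ∀ t ∈ A.dom i, A.c i t = x →
      derivWithin ((L ∘ e) ∘ A.c i) (A.dom i) t ≠ 0 := by
    rintro x ⟨hx, hxb⟩ i t ht htx
    obtain ⟨y, ⟨hy, hy'⟩, hyx⟩ := (hball hxb).2
    rw [e.injOn hy hx hyx] at hy'
    exact hy' i t ht htx ht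
  have himg : e '' (e.source ∩ e ⁻¹' Metric.ball (e p) r) = Metric.ball (e p) r := by
    refine Subset.antisymm (image_subset_iff.2 inter_subset_right) fun y hy => ?_
    have hyt := (hball hy).1
    exact ⟨e.symm y, ⟨e.map_target hyt, by rwa [mem_preimage, e.right_inv hyt]⟩, e.right_inv hyt⟩
  refine ⟨e.source ∩ e ⁻¹' Metric.ball (e p) r, L ∘ e,
    ⟨e.isOpen_inter_preimage Metric.isOpen_ball, ?_, ?_, fun i t ht hD => hsmooth i t ht hD.1,
      fun i t ht hD => hgood _ hD i t ht rfl⟩, mem_chart_source _ p, Metric.mem_ball_self hr⟩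
  · have := (convex_ball (e p) r).contractibleSpace ⟨_, Metric.mem_ball_self hr⟩
    exact (e.homeomorphOfImageSubsetSource inter_subset_left himg).contractibleSpace
  · exact L.continuous.comp_continuousOn (e.continuousOn.mono inter_subset_left)

namespace IsHeight

variable {D : Set M} {h : M → ℝ}

theorem comp_continuousOn (H : IsHeight A D h) {i : A.ι} {S : Set ℝ} (hS : S ⊆ A.dom i)
    (hD : MapsTo (A.c i) S D) : ContinuousOn (h ∘ A.c i) S :=
  H.continuousOn.comp ((A.continuousOn i).mono hS) hD

theorem derivWithin_Icc (H : IsHeight A D h) {i : A.ι} {u v : ℝ} (huv : u < v)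
    (hS : Icc u v ⊆ A.dom i) (hD : MapsTo (A.c i) (Icc u v) D) {t : ℝ} (ht : t ∈ Icc u v) :
    derivWithin (h ∘ A.c i) (Icc u v) t ≠ 0 := by
  rw [derivWithin_subset hS (uniqueDiffOn_Icc huv t ht)
    ((H.contDiff i t (hS ht) (hD ht)).differentiableWithinAt (by simp))]
  exact H.deriv_ne i t (hS ht) (hD ht)

theorem contDiffOn (H : IsHeight A D h) {i : A.ι} {S : Set ℝ} (hS : S ⊆ A.dom i)
    (hD : MapsTo (A.c i) S D) : ContDiffOn ℝ ∞ (h ∘ A.c i) S :=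
  fun t ht => (H.contDiff i t (hS ht) (hD ht)).mono hS

theorem strictMonoOn_or_strictAntiOn (H : IsHeight A D h) {i : A.ι} {u v : ℝ}
    (hS : Icc u v ⊆ A.dom i) (hD : MapsTo (A.c i) (Icc u v) D) :
    StrictMonoOn (h ∘ A.c i) (Icc u v) ∨ StrictAntiOn (h ∘ A.c i) (Icc u v) := by
  rcases lt_or_ge u v with huv | huv
  · exact (strictMonoOn_or_strictAntiOn_of_derivWithin_ne_zero
      (fun t ht => (H.contDiffOn hS hD t ht).differentiableWithinAt (by simp))
      fun t ht => H.derivWithin_Icc huv hS hD ht).imp And.left And.left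
  · exact .inl ((subsingleton_Icc_of_ge huv).strictMonoOn _)

theorem injOn (H : IsHeight A D h) {i : A.ι} {u v : ℝ}
    (hS : Icc u v ⊆ A.dom i) (hD : MapsTo (A.c i) (Icc u v) D) :
    InjOn (h ∘ A.c i) (Icc u v) :=
  (H.strictMonoOn_or_strictAntiOn hS hD).elim StrictMonoOn.injOn StrictAntiOn.injOn

theorem apply_mem_uIcc (H : IsHeight A D h) {i : A.ι} {u v t : ℝ} (ht : t ∈ Icc u v)
    (hS : Icc u v ⊆ A.dom i) (hD : MapsTo (A.c i) (Icc u v) D) :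
    h (A.c i t) ∈ uIcc (h (A.c i u)) (h (A.c i v)) := by
  have huv : u ≤ v := ht.1.trans ht.2
  have hu := left_mem_Icc.2 huv
  have hv := right_mem_Icc.2 huv
  rcases H.strictMonoOn_or_strictAntiOn hS hD with hm | hm
  · exact mem_uIcc.2 (.inl ⟨hm.monotoneOn hu ht ht.1, hm.monotoneOn ht hv ht.2⟩)
  · exact mem_uIcc.2 (.inr ⟨hm.antitoneOn ht hv ht.2, hm.antitoneOn hu ht ht.1⟩)

/-- The height maps the part of an arc between two parameters onto the open interval between the
heights of the two points. -/
theorem image_Ioo (H : IsHeight A D h) {i : A.ι} {u v : ℝ} (huv : u ≤ v)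
    (hS : Icc u v ⊆ A.dom i) (hD : MapsTo (A.c i) (Icc u v) D) :
    h '' (A.c i '' Ioo u v) = uIoo (h (A.c i u)) (h (A.c i v)) := by
  have hu := left_mem_Icc.2 huv
  have hv := right_mem_Icc.2 huv
  have hc := H.comp_continuousOn hS hD
  rw [← image_comp]
  refine Subset.antisymm ?_ ?_
  · rintro _ ⟨t, ht, rfl⟩
    have htI := Ioo_subset_Icc_self ht
    rcases H.strictMonoOn_or_strictAntiOn hS hD with hm | hm
    · have h1 : (h ∘ A.c i) u < (h ∘ A.c i) t := hm hu htI ht.1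
      have h2 : (h ∘ A.c i) t < (h ∘ A.c i) v := hm htI hv ht.2
      exact mem_uIoo_of_lt h1 h2
    · have h1 : (h ∘ A.c i) t < (h ∘ A.c i) u := hm hu htI ht.1
      have h2 : (h ∘ A.c i) v < (h ∘ A.c i) t := hm htI hv ht.2
      exact mem_uIoo_of_gt h2 h1
  · rcases le_total (h (A.c i u)) (h (A.c i v)) with hle | hle
    · rw [uIoo_of_le hle]
      exact intermediate_value_Ioo huv hc
    · rw [uIoo_of_ge hle]
      exact intermediate_value_Ioo' huv hc

theorem exists_Icc (H : IsHeight A D h) {i : A.ι} {t : ℝ} (ht : t ∈ A.dom i) (hD : A.c i t ∈ D) :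
    ∀ᶠ ε in 𝓝[>] (0 : ℝ), MapsTo (A.c i) (A.dom i ∩ Icc (t - ε) (t + ε)) D := by
  have h1 : ∀ᶠ s in 𝓝 t, s ∈ A.dom i → A.c i s ∈ D :=
    eventually_nhdsWithin_iff.1 ((A.continuousOn i t ht).eventually_mem (H.isOpen.mem_nhds hD))
  obtain ⟨δ, hδ, hball⟩ := Metric.eventually_nhds_iff.1 h1
  filter_upwards [Ioo_mem_nhdsGT hδ] with ε hε s hs
  refine hball ?_ hs.1
  rw [Real.dist_eq, abs_lt]
  constructor <;> linarith [hs.2.1, hs.2.2, hε.2]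

end IsHeight

end Heights

/-! ### Nice points are generic -/

section LocalArcs

open Filter

variable {N : ℕ} {M : Type*} [TopologicalSpace M] [ChartedSpace (EuclideanSpace ℝ (Fin N)) M]

theorem SmoothImmersionOn.mono {f : ℝ → M} {s t : Set ℝ} (hf : SmoothImmersionOn N f s)
    (hts : t ⊆ s) (ht : UniqueDiffOn ℝ t) : SmoothImmersionOn N f t := by
  refine ⟨hf.1.mono hts, fun x hx => ?_⟩
  rw [mfderivWithin_subset hts (uniqueMDiffWithinAt_iff_uniqueDiffWithinAt.2 (ht x hx))
    ((hf.1 x (hts hx)).mdifferentiableWithinAt (by simp))]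
  exact hf.2 x (hts hx)

variable (N) in
/-- Near the point `x`, the set `Y` is an embedded interval. -/
def IsLocArc (Y : Set M) (x : M) : Prop := ∃ U ∈ 𝓝 x, IsEmbeddedInterval N (U ∩ Y)

/-- As γ is a topological embedding, an open set of M cuts out any smaller parameter interval. This
makes the notion local in Y. -/
theorem IsLocArc.exists_subset {Y : Set M} {x : M} (h : IsLocArc N Y x) (hx : x ∈ Y) {O : Set M}
    (hO : O ∈ 𝓝 x) : ∃ U ∈ 𝓝 x, U ⊆ O ∧ IsEmbeddedInterval N (U ∩ Y) := by
  obtain ⟨U, hU, a, b, γ, hab, hγ, hemb, himg⟩ := h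
  obtain ⟨t, ht, rfl⟩ : x ∈ γ '' Ioo a b := himg ▸ ⟨mem_of_mem_nhds hU, hx⟩
  have hab' : Ioo a b ∈ 𝓝 t := Ioo_mem_nhds ht.1 ht.2
  have hpre : γ ⁻¹' O ∩ Ioo a b ∈ 𝓝 t :=
    inter_mem ((hγ.1.continuousOn.continuousAt hab').preimage_mem_nhds hO) hab'
  obtain ⟨a', b', ht', hsub⟩ := mem_nhds_iff_exists_Ioo_subset.1 hpre
  obtain ⟨V, hV, hVeq⟩ := hemb.isInducing.isOpen_iff.1
    (isOpen_Ioo.preimage continuous_subtype_val : IsOpen ((↑) ⁻¹' Ioo a' b' : Set (Ioo a b)))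
  have hVmem : ∀ s (hs : s ∈ Ioo a b), γ s ∈ V ↔ s ∈ Ioo a' b' := fun s hs => by
    have := Set.ext_iff.1 hVeq ⟨s, hs⟩
    simpa using this
  have hVx : γ t ∈ V := (hVmem t ht).2 ht'
  refine ⟨V ∩ U ∩ O, inter_mem (inter_mem (hV.mem_nhds hVx) hU) hO, inter_subset_right, a', b', γ,
    ht'.1.trans ht'.2, hγ.mono (fun s hs => (hsub hs).2) isOpen_Ioo.uniqueDiffOn, ?_, ?_⟩
  · exact hemb.comp (IsEmbedding.inclusion fun s hs => (hsub hs).2)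
  · ext y
    constructor
    · rintro ⟨⟨⟨hyV, hyU⟩, hyO⟩, hyY⟩
      obtain ⟨s, hs, rfl⟩ : y ∈ γ '' Ioo a b := himg ▸ ⟨hyU, hyY⟩
      exact mem_image_of_mem γ ((hVmem s hs).1 hyV)
    · rintro ⟨s, hs, rfl⟩
      have h1 : γ s ∈ U ∩ Y := himg ▸ mem_image_of_mem γ (hsub hs).2
      exact ⟨⟨⟨(hVmem s (hsub hs).2).2 hs, h1.1⟩, (hsub hs).1⟩, h1.2⟩

theorem IsLocArc.congr {Y Y' : Set M} {x : M} (h : IsLocArc N Y x) (hx : x ∈ Y) {O : Set M}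
    (hO : O ∈ 𝓝 x) (hYY' : O ∩ Y = O ∩ Y') : IsLocArc N Y' x := by
  obtain ⟨U, hU, hUO, hemb⟩ := h.exists_subset hx hO
  refine ⟨U, hU, ?_⟩
  rwa [← inter_eq_left.2 hUO, inter_assoc, ← hYY', ← inter_assoc, inter_eq_left.2 hUO]

variable {A : ArcSystem N M} {D : Set M} {h : M → ℝ}

/-- Rational endpoints leave only countably many pieces of arcs to consider in the category
arguments. -/
theorem IsHeight.exists_rat (H : IsHeight A D h) {i : A.ι} {t : ℝ} (ht : t ∈ A.dom i)
    (hD : A.c i t ∈ D) : ∃ r₁ r₂ : ℚ, (r₁ : ℝ) < t ∧ t < r₂ ∧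
      MapsTo (A.c i) (A.dom i ∩ Icc (r₁ : ℝ) r₂) D ∧
      InjOn (h ∘ A.c i) (A.dom i ∩ Icc (r₁ : ℝ) r₂) := by
  obtain ⟨ε, hε, h0⟩ := ((H.exists_Icc ht hD).and self_mem_nhdsWithin).exists
  replace h0 : 0 < ε := h0
  obtain ⟨r₁, hr₁, hr₁'⟩ := exists_rat_btwn (show t - ε < t by linarith)
  obtain ⟨r₂, hr₂, hr₂'⟩ := exists_rat_btwn (show t < t + ε by linarith)
  have hmaps : MapsTo (A.c i) (A.dom i ∩ Icc (r₁ : ℝ) r₂) D :=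
    hε.mono_left (inter_subset_inter_right _ (Icc_subset_Icc hr₁.le hr₂'.le))
  refine ⟨r₁, r₂, hr₁', hr₂, hmaps, ?_⟩
  have hsub : A.dom i ∩ Icc (r₁ : ℝ) r₂ ⊆ A.dom i := inter_subset_left
  rw [ArcSystem.dom, Icc_inter_Icc] at *
  exact H.injOn hsub hmaps

/-- Around any interior parameter there is an interval mapped into a given neighbourhood. -/
theorem ArcSystem.exists_Icc_subset {i : A.ι} {t : ℝ} (ht : t ∈ Ioo (A.a i) (A.b i)) {P : Set ℝ}
    (hP : P ∈ 𝓝 t) : ∃ u v, t ∈ Ioo u v ∧ Icc u v ⊆ A.dom i ∩ P := by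
  obtain ⟨u, v, huv, hn, hsub⟩ :=
    exists_Icc_mem_subset_of_mem_nhds (inter_mem (Icc_mem_nhds ht.1 ht.2) hP)
  have := mem_interior_iff_mem_nhds.2 hn
  rw [interior_Icc] at this
  exact ⟨u, v, this, hsub⟩

theorem ArcSystem.mem_Ioo {i : A.ι} {t : ℝ} (ht : t ∈ A.dom i) {O : Set M} (hO : A.c i t ∈ O)
    (hend : ∀ i, A.c i (A.a i) ∉ O ∧ A.c i (A.b i) ∉ O) : t ∈ Ioo (A.a i) (A.b i) := by
  refine ⟨lt_of_le_of_ne ht.1 ?_, lt_of_le_of_ne ht.2 ?_⟩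
  · rintro rfl
    exact (hend i).1 hO
  · rintro rfl
    exact (hend i).2 hO

/-- One arc through x already attains all heights close to h x, so injectivity leaves room for no
other point of the carrier near x. -/
theorem IsHeight.isLocArc_of_injOn [T2Space M] (H : IsHeight A D h) {O : Set M} (hO : IsOpen O)
    (hOD : O ⊆ D) (hend : ∀ i, A.c i (A.a i) ∉ O ∧ A.c i (A.b i) ∉ O)
    (hinj : InjOn h (O ∩ A.carrier)) {x : M} (hx : x ∈ O) (hxA : x ∈ A.carrier) :
    IsLocArc N A.carrier x := by
  obtain ⟨i, t, ht, rfl⟩ := ArcSystem.mem_carrier.1 hxA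
  have htI := ArcSystem.mem_Ioo ht hx hend
  have hn : A.dom i ∈ 𝓝 t := Icc_mem_nhds htI.1 htI.2
  obtain ⟨u, v, htuv, hsub⟩ := ArcSystem.exists_Icc_subset htI
    (((A.continuousOn i).continuousAt hn).preimage_mem_nhds (hO.mem_nhds hx))
  have huv : u ≤ v := (htuv.1.trans htuv.2).le
  have hS : Icc u v ⊆ A.dom i := fun s hs => (hsub hs).1
  have hD : MapsTo (A.c i) (Icc u v) D := fun s hs => hOD (hsub hs).2
  have himg := H.image_Ioo huv hS hD
  have hcinj : InjOn (A.c i) (Icc u v) := fun s hs s' hs' hss =>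
    H.injOn hS hD hs hs' (congrArg h hss)
  refine ⟨O ∩ h ⁻¹' uIoo (h (A.c i u)) (h (A.c i v)),
    ((H.continuousOn.mono hOD).isOpen_inter_preimage hO
      (isOpen_Ioo : IsOpen (uIoo (h (A.c i u)) (h (A.c i v))))).mem_nhds ⟨hx, ?_⟩,
    u, v, A.c i, htuv.1.trans htuv.2,
    (A.imm i).mono (Ioo_subset_Icc_self.trans hS) isOpen_Ioo.uniqueDiffOn, ?_, ?_⟩
  · have hmem : h (A.c i t) ∈ uIoo (h (A.c i u)) (h (A.c i v)) :=
      himg ▸ mem_image_of_mem h (mem_image_of_mem _ htuv)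
    exact hmem
  · have hc : Continuous ((Icc u v).domRestrict (A.c i)) :=
      continuousOn_iff_continuous_domRestrict.1 ((A.continuousOn i).mono hS)
    have h1 := hc.isClosedEmbedding (injOn_iff_injective.1 hcinj)
    exact h1.isEmbedding.comp (IsEmbedding.inclusion Ioo_subset_Icc_self)
  · ext y
    constructor
    · rintro ⟨⟨hyO, hyh⟩, hyA⟩
      rw [mem_preimage, ← himg] at hyh
      obtain ⟨_, ⟨s, hs, rfl⟩, hsy⟩ := hyh
      have hsI := Ioo_subset_Icc_self hs
      exact ⟨s, hs, hinj ⟨(hsub hsI).2, A.apply_mem (hS hsI)⟩ ⟨hyO, hyA⟩ hsy⟩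
    · rintro ⟨s, hs, rfl⟩
      have hsI := Ioo_subset_Icc_self hs
      refine ⟨⟨(hsub hsI).2, ?_⟩, A.apply_mem (hS hsI)⟩
      rw [mem_preimage, ← himg]
      exact mem_image_of_mem h (mem_image_of_mem _ hs)

/-- A point is nice if no arc ends there and the union of the arcs is, near the point, mapped
injectively by any height. -/
def ArcSystem.IsNice (A : ArcSystem N M) (q : M) : Prop :=
  ∀ D h, IsHeight A D h → q ∈ D → ∃ O, IsOpen O ∧ q ∈ O ∧ O ⊆ D ∧
    (∀ i, A.c i (A.a i) ∉ O ∧ A.c i (A.b i) ∉ O) ∧ InjOn h (O ∩ A.carrier)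

theorem ArcSystem.IsNice.isLocArc [T2Space M] [IsManifold (𝓡 N) ∞ M] {q : M} (hq : A.IsNice q)
    (hqA : q ∈ A.carrier) : IsLocArc N A.carrier q := by
  obtain ⟨D, h, H, hD⟩ := A.exists_isHeight q
  obtain ⟨O, hO, hqO, hOD, hend, hinj⟩ := hq D h H hD
  exact H.isLocArc_of_injOn hO hOD hend hinj hqO hqA

/-- For each piece of an arc k, the parameters at which arc i lies on that piece form a closed set,
whose frontier is nowhere dense. Off these frontiers and the arc endpoints, every arc meeting arc i
at the point locally contains it, and by the height is also locally contained in it. -/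
theorem ArcSystem.isMeagre_not_isNice [T2Space M] [IsManifold (𝓡 N) ∞ M] (A : ArcSystem N M)
    (i : A.ι) : IsMeagre {t | t ∈ A.dom i ∧ ¬ A.IsNice (A.c i t)} := by
  have := A.finite
  let P : A.ι → ℚ → ℚ → Set ℝ := fun k r₁ r₂ =>
    A.dom i ∩ A.c i ⁻¹' (A.c k '' (A.dom k ∩ Icc (r₁ : ℝ) r₂))
  have hPcl : ∀ k r₁ r₂, IsClosed (P k r₁ r₂) := fun k r₁ r₂ =>
    (A.continuousOn i).preimage_isClosed_of_isClosed isClosed_Icc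
      ((isCompact_Icc.inter_right isClosed_Icc).image_of_continuousOn
        ((A.continuousOn k).mono inter_subset_left)).isClosed
  have hPm : ∀ k r₁ r₂, IsMeagre (frontier (P k r₁ r₂)) := fun k r₁ r₂ =>
    (isClosed_frontier.isNowhereDense_iff.2 (interior_frontier (hPcl k r₁ r₂))).isMeagre
  let E : Set M := range (fun k => A.c k (A.a k)) ∪ range fun k => A.c k (A.b k)
  have hE : E.Finite := (finite_range _).union (finite_range _)
  let F : Set ℝ := ⋃ q ∈ E, {t | t ∈ A.dom i ∧ A.c i t = q}
  have hF : F.Finite := hE.biUnion fun q _ => A.finite_fiber i q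
  have hFm : IsMeagre F := by
    refine (hF.isClosed.isNowhereDense_iff.2 ?_).isMeagre
    by_contra hne
    obtain ⟨y, hy⟩ := nonempty_iff_ne_empty.2 hne
    exact infinite_of_mem_nhds y (mem_interior_iff_mem_nhds.1 hy) hF
  refine IsMeagre.mono (s := F ∪ ⋃ k, ⋃ r₁, ⋃ r₂, frontier (P k r₁ r₂)) ?_
    (hFm.union (isMeagre_iUnion fun k => isMeagre_iUnion fun r₁ => isMeagre_iUnion fun r₂ =>
      hPm k r₁ r₂))
  rintro t ⟨ht, hnice⟩
  by_contra hbad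
  simp only [mem_union, mem_iUnion, not_or, not_exists] at hbad
  obtain ⟨htF, htP⟩ := hbad
  have htE : A.c i t ∉ E := fun hmem => htF (mem_iUnion₂.2 ⟨_, hmem, ht, rfl⟩)
  have htI : t ∈ Ioo (A.a i) (A.b i) := by
    refine ArcSystem.mem_Ioo (O := Eᶜ) ht htE fun k => ⟨?_, ?_⟩
    · exact fun hk => hk (.inl ⟨k, rfl⟩)
    · exact fun hk => hk (.inr ⟨k, rfl⟩)
  refine hnice fun D h H hD => ?_
  obtain ⟨r₁, r₂, hr₁, hr₂, hmaps, hinj⟩ := H.exists_rat ht hD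
  have hev : ∀ k, ∀ᶠ x in 𝓝 (A.c i t), ∀ w ∈ A.dom k, A.c k w = x →
      w ∈ {w | w ∈ A.dom k → A.c k w ∈ A.c i '' (A.dom i ∩ Icc (r₁ : ℝ) r₂)} := by
    refine fun k => A.eventually_mem_of_fiber fun w hw hwt => ?_
    obtain ⟨s₁, s₂, hs₁, hs₂, hmaps', hinj'⟩ := H.exists_rat hw (hwt ▸ hD)
    have htmem : t ∈ P k s₁ s₂ := ⟨ht, w, ⟨hw, hs₁.le, hs₂.le⟩, hwt⟩
    -- The parameter t avoids the frontier, so arc i runs along the piece of arc k on a whole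
    -- neighborhood of t.
    have hPn : P k s₁ s₂ ∈ 𝓝 t := by
      rw [← mem_interior_iff_mem_nhds]
      by_contra hni
      exact htP k s₁ s₂ ((hPcl k s₁ s₂).frontier_eq ▸ ⟨htmem, hni⟩)
    obtain ⟨u, v, htuv, hsub⟩ := ArcSystem.exists_Icc_subset htI
      (inter_mem hPn (Icc_mem_nhds hr₁ hr₂))
    have hS : Icc u v ⊆ A.dom i := fun s hs => (hsub hs).1
    have hD' : MapsTo (A.c i) (Icc u v) D := fun s hs => hmaps ⟨hS hs, (hsub hs).2.2⟩
    have himg := H.image_Ioo (htuv.1.trans htuv.2).le hS hD'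
    have hmem : h (A.c k w) ∈ uIoo (h (A.c i u)) (h (A.c i v)) := by
      rw [← himg, hwt]
      exact mem_image_of_mem h (mem_image_of_mem _ htuv)
    have hcw : ContinuousWithinAt (h ∘ A.c k) (A.dom k) w :=
      (H.contDiff k w hw (hwt ▸ hD)).continuousWithinAt
    have h1 : ∀ᶠ w' in 𝓝[A.dom k] w, h (A.c k w') ∈ uIoo (h (A.c i u)) (h (A.c i v)) :=
      hcw.eventually_mem (isOpen_Ioo.mem_nhds hmem)
    filter_upwards [eventually_nhdsWithin_iff.1 h1, Icc_mem_nhds hs₁ hs₂] with w' hw' hw'I hw'k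
    have hw'' := hw' hw'k
    rw [← himg] at hw''
    obtain ⟨_, ⟨t', ht', rfl⟩, heq⟩ := hw''
    have ht'I := Ioo_subset_Icc_self ht'
    obtain ⟨w₂, hw₂, hw₂'⟩ := (hsub ht'I).2.1.2
    -- A point of arc k near the meeting point shares its height with a point of arc i, which itself
    -- lies on arc k; the height is injective on this piece, so the two points agree.
    have : w₂ = w' := hinj' hw₂ ⟨hw'k, hw'I⟩ (by simp [hw₂', heq])
    subst this
    exact ⟨t', ⟨hS ht'I, (hsub ht'I).2.2⟩, hw₂'.symm⟩
  rw [← eventually_all] at hev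
  obtain ⟨U, hU, hUo, htU⟩ := mem_nhds_iff.1 hev
  refine ⟨U ∩ D ∩ Eᶜ, (hUo.inter H.isOpen).inter hE.isClosed.isOpen_compl, ⟨⟨htU, hD⟩, htE⟩,
    fun x hx => hx.1.2, fun k => ⟨fun hk => hk.2 (.inl ⟨k, rfl⟩), fun hk => hk.2 (.inr ⟨k, rfl⟩)⟩,
    ?_⟩
  have hsub : U ∩ D ∩ Eᶜ ∩ A.carrier ⊆ A.c i '' (A.dom i ∩ Icc (r₁ : ℝ) r₂) := by
    rintro x ⟨⟨⟨hxU, -⟩, -⟩, hxA⟩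
    obtain ⟨k, w, hw, rfl⟩ := ArcSystem.mem_carrier.1 hxA
    exact hU hxU k w hw rfl hw
  intro x hx y hy hxy
  obtain ⟨s, hs, rfl⟩ := hsub hx
  obtain ⟨s', hs', rfl⟩ := hsub hy
  rw [hinj hs hs' hxy]

/-- On each of countably many pieces the height is a continuous injection of the parameter, hence it
preserves meagreness. -/
theorem IsHeight.isMeagre_levels [T2Space M] [IsManifold (𝓡 N) ∞ M] (H : IsHeight A D h) :
    IsMeagre {s | ∃ x ∈ D ∩ A.carrier, ¬ A.IsNice x ∧ h x = s} := by
  have := A.finite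
  let Q : A.ι → ℚ → ℚ → Prop := fun i r₁ r₂ => MapsTo (A.c i) (A.dom i ∩ Icc (r₁ : ℝ) r₂) D
  refine IsMeagre.mono (s := ⋃ i, ⋃ r₁ : ℚ, ⋃ r₂ : ℚ, ⋃ _ : Q i r₁ r₂, (h ∘ A.c i) ''
    ({t | t ∈ A.dom i ∧ ¬ A.IsNice (A.c i t)} ∩ (A.dom i ∩ Icc (r₁ : ℝ) r₂))) ?_
    (isMeagre_iUnion fun i => isMeagre_iUnion fun r₁ => isMeagre_iUnion fun r₂ =>
      isMeagre_iUnion fun hQ => ?_)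
  · rintro _ ⟨x, ⟨hxD, hxA⟩, hx, rfl⟩
    obtain ⟨i, t, ht, rfl⟩ := ArcSystem.mem_carrier.1 hxA
    obtain ⟨r₁, r₂, hr₁, hr₂, hmaps, -⟩ := H.exists_rat ht hxD
    simp only [mem_iUnion]
    exact ⟨i, r₁, r₂, hmaps, t, ⟨⟨ht, hx⟩, ht, hr₁.le, hr₂.le⟩, rfl⟩
  · have hS : A.dom i ∩ Icc (r₁ : ℝ) r₂ ⊆ A.dom i := inter_subset_left
    have hm := A.isMeagre_not_isNice i
    have hQ' : MapsTo (A.c i) (A.dom i ∩ Icc (r₁ : ℝ) r₂) D := hQ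
    rw [ArcSystem.dom, Icc_inter_Icc] at *
    exact isMeagre_image_of_injOn (H.comp_continuousOn hS hQ') (H.injOn hS hQ') hm

theorem IsHeight.finite_level [T2Space M] (H : IsHeight A D h) {K : Set M} (hK : IsClosed K)
    (hKD : K ∩ A.carrier ⊆ D) (s : ℝ) : {x | x ∈ K ∩ A.carrier ∧ h x = s}.Finite := by
  have := A.finite
  have hsub : {x | x ∈ K ∩ A.carrier ∧ h x = s} ⊆
      ⋃ i, A.c i '' (A.dom i ∩ A.c i ⁻¹' K ∩ (h ∘ A.c i) ⁻¹' {s}) := by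
    rintro x ⟨⟨hxK, hxA⟩, hx⟩
    obtain ⟨i, t, ht, rfl⟩ := ArcSystem.mem_carrier.1 hxA
    exact mem_iUnion.2 ⟨i, t, ⟨⟨ht, hxK⟩, hx⟩, rfl⟩
  refine (finite_iUnion fun i => Finite.image _ ?_).subset hsub
  have hcl : IsClosed (A.dom i ∩ A.c i ⁻¹' K) :=
    (A.continuousOn i).preimage_isClosed_of_isClosed isClosed_Icc hK
  have hcl' : IsClosed (A.dom i ∩ A.c i ⁻¹' K ∩ (h ∘ A.c i) ⁻¹' {s}) :=
    (H.comp_continuousOn inter_subset_left fun t ht =>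
      hKD ⟨ht.2, A.apply_mem ht.1⟩).preimage_isClosed_of_isClosed hcl isClosed_singleton
  refine finite_of_isCompact_of_isolated ((isCompact_Icc (a := A.a i) (b := A.b i)).of_isClosed_subset
    hcl' fun t ht => ht.1.1) ?_
  rintro t ⟨⟨ht, htK⟩, hts⟩
  obtain ⟨r₁, r₂, hr₁, hr₂, -, hinj⟩ := H.exists_rat ht (hKD ⟨htK, A.apply_mem ht⟩)
  refine ⟨Icc (r₁ : ℝ) r₂, Icc_mem_nhds hr₁ hr₂, fun x hx hx' => ?_⟩
  exact hinj ⟨hx'.1.1, hx⟩ ⟨ht, hr₁.le, hr₂.le⟩ (hx'.2.trans hts.symm)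

theorem IsHeight.exists_gap [T2Space M] (H : IsHeight A D h) {K : Set M} (hK : IsClosed K)
    (hKD : K ∩ A.carrier ⊆ D) {s : ℝ} (hs : ∀ x ∈ K ∩ A.carrier, h x ≠ s) :
    ∃ δ > 0, ∀ x ∈ K ∩ A.carrier, h x ∉ Ioo (s - δ) (s + δ) := by
  have hc : IsCompact (h '' (K ∩ A.carrier)) :=
    (A.isCompact_carrier.inter_left hK).image_of_continuousOn (H.continuousOn.mono hKD)
  have hns : s ∉ h '' (K ∩ A.carrier) := by
    rintro ⟨x, hx, hxs⟩
    exact hs x hx hxs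
  obtain ⟨δ, hδ, hball⟩ := Metric.mem_nhds_iff.1 (hc.isClosed.isOpen_compl.mem_nhds hns)
  rw [Real.ball_eq_Ioo] at hball
  exact ⟨δ, hδ, fun x hx hmem => hball hmem (mem_image_of_mem h hx)⟩

end LocalArcs

/-! ### Cells around a point -/

section Cells

open Filter

variable {N : ℕ} {M : Type*} [TopologicalSpace M] [ChartedSpace (EuclideanSpace ℝ (Fin N)) M]

/-- The part of the `i`-th arc over `[u, v]` runs inside `O`, from `p` to a point outside `O` or
the other way around. -/
structure IsHalfArc (A : ArcSystem N M) (O : Set M) (p : M) (i : A.ι) (u v : ℝ) : Prop where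
  lt : u < v
  subset : Icc u v ⊆ A.dom i
  mapsTo : MapsTo (A.c i) (Ioo u v) (O \ {p})
  ends : (A.c i u = p ∧ A.c i v ∉ O) ∨ (A.c i v = p ∧ A.c i u ∉ O)

/-- An open set whose arcs all run through the point `p`, from the level `s` to the level `s'` of
a height, unless they end at `p`. -/
structure IsPreCell (A : ArcSystem N M) (O : Set M) (p : M) (D : Set M) (h : M → ℝ) (s s' : ℝ) :
    Prop where
  isHeight : IsHeight A D h
  isOpen : IsOpen O
  mem : p ∈ O
  mem_carrier : p ∈ A.carrier
  closure_subset : closure O ∩ A.carrier ⊆ D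
  lt_left : s < h p
  lt_right : h p < s'
  level : ∀ x ∈ closure O ∩ A.carrier, h x = h p → x = p
  levels : ∀ x ∈ O ∩ A.carrier, h x ∈ Ioo s s'
  boundary : ∀ x ∈ closure O ∩ A.carrier, x ∉ O → h x = s ∨ h x = s'
  endpoint : ∀ i, (A.c i (A.a i) ∈ O → A.c i (A.a i) = p) ∧ (A.c i (A.b i) ∈ O → A.c i (A.b i) = p)

/-- A cell of a web: the half arcs in the open set `O` form a tassel based on `p`. -/
structure IsCell (A : ArcSystem N M) (O : Set M) (p : M) : Prop where
  pre : ∃ D h s s', IsPreCell A O p D h s s'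
  meet : ∀ i u v j u' v', IsHalfArc A O p i u v → IsHalfArc A O p j u' v' →
    (A.c i '' Ioo u v ∩ A.c j '' Ioo u' v').Nonempty →
      ∃ᶠ x in 𝓝 p, x ∈ A.c i '' Ioo u v ∩ A.c j '' Ioo u' v'
  types : ∀ x ∈ O ∩ A.carrier, x ≠ p → IsLocArc N A.carrier x →
    ∃ᶠ y in 𝓝 p, y ∈ O ∩ A.carrier ∧ y ≠ p ∧ IsLocArc N A.carrier y ∧
      ∀ i u v, IsHalfArc A O p i u v → (x ∈ A.c i '' Ioo u v ↔ y ∈ A.c i '' Ioo u v)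

variable {A : ArcSystem N M} {O : Set M} {p : M} {D : Set M} {h : M → ℝ} {s s' : ℝ}

theorem IsHalfArc.mapsTo_closure {i : A.ι} {u v : ℝ} (ha : IsHalfArc A O p i u v) :
    MapsTo (A.c i) (Icc u v) (closure O ∩ A.carrier) := by
  intro t ht
  refine ⟨?_, A.apply_mem (ha.subset ht)⟩
  have h1 : t ∈ closure (Ioo u v) := by rwa [closure_Ioo ha.lt.ne]
  have h2 : ContinuousWithinAt (A.c i) (Ioo u v) t :=
    (A.continuousOn i t (ha.subset ht)).mono (Ioo_subset_Icc_self.trans ha.subset)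
  exact h2.mem_closure h1 fun x hx => (ha.mapsTo hx).1

theorem IsHalfArc.image_subset {i : A.ι} {u v : ℝ} (ha : IsHalfArc A O p i u v) :
    A.c i '' Ioo u v ⊆ O ∩ A.carrier := by
  rintro _ ⟨t, ht, rfl⟩
  exact ⟨(ha.mapsTo ht).1, A.apply_mem (ha.subset (Ioo_subset_Icc_self ht))⟩

theorem IsPreCell.mapsTo_halfArc (hc : IsPreCell A O p D h s s') {i : A.ι} {u v : ℝ}
    (ha : IsHalfArc A O p i u v) : MapsTo (A.c i) (Icc u v) D :=
  fun _ ht => hc.closure_subset (ha.mapsTo_closure ht)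

theorem IsPreCell.image_halfArc (hc : IsPreCell A O p D h s s') {i : A.ι} {u v : ℝ}
    (ha : IsHalfArc A O p i u v) :
    h '' (A.c i '' Ioo u v) = Ioo (h p) s' ∨ h '' (A.c i '' Ioo u v) = Ioo s (h p) := by
  rw [hc.isHeight.image_Ioo ha.lt.le ha.subset (hc.mapsTo_halfArc ha)]
  rcases ha.ends with ⟨h1, h2⟩ | ⟨h1, h2⟩
  · rw [h1]
    rcases hc.boundary _ (ha.mapsTo_closure (right_mem_Icc.2 ha.lt.le)) h2 with h3 | h3 <;> rw [h3]
    · exact .inr (uIoo_of_ge hc.lt_left.le)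
    · exact .inl (uIoo_of_le hc.lt_right.le)
  · rw [h1]
    rcases hc.boundary _ (ha.mapsTo_closure (left_mem_Icc.2 ha.lt.le)) h2 with h3 | h3 <;> rw [h3]
    · exact .inr (uIoo_of_le hc.lt_left.le)
    · exact .inl (uIoo_of_ge hc.lt_right.le)

theorem IsHeight.mem_Icc_of_mem_closure (H : IsHeight A D h) {x : M} (hx : x ∈ D)
    (hxO : x ∈ closure (h ⁻¹' Ioo s s')) : h x ∈ Icc s s' := by
  have h1 : ContinuousAt h x := H.continuousOn.continuousAt (H.isOpen.mem_nhds hx)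
  exact closure_minimal Ioo_subset_Icc_self isClosed_Icc
    (h1.continuousWithinAt.mem_closure hxO fun y hy => hy)

theorem mem_of_mem_closure_of_gap {K : Set M} (hK : IsOpen K) {σ δ : ℝ}
    (hgap : ∀ x ∈ frontier K ∩ A.carrier, h x ∉ Ioo (σ - δ) (σ + δ)) {x : M} (hx : x ∈ closure K)
    (hxA : x ∈ A.carrier) (hhx : h x ∈ Ioo (σ - δ) (σ + δ)) : x ∈ K := by
  by_contra hxK
  exact hgap x ⟨⟨hx, by rwa [hK.interior_eq]⟩, hxA⟩ hhx

/-- There are finitely many one-sided germs of arcs at p, hence finitely many incidence patterns;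
patterns that do not recur at p are removed by shrinking the neighborhood. The set K is independent
of the levels, so these may later be chosen nice. -/
theorem ArcSystem.exists_cell [T2Space M] [IsManifold (𝓡 N) ∞ M] (H : IsHeight A D h) (hpD : p ∈ D)
    (hpA : p ∈ A.carrier) {Ω : Set M} (hΩ : Ω ∈ 𝓝 p) :
    ∃ K, ∃ δ > 0, IsOpen K ∧ p ∈ K ∧ closure K ⊆ Ω ∩ D ∧ ∀ s ∈ Ioo (h p - δ) (h p),
      ∀ s' ∈ Ioo (h p) (h p + δ), IsCell A (K ∩ h ⁻¹' Ioo s s') p ∧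
        ∀ x ∈ frontier (K ∩ h ⁻¹' Ioo s s') ∩ A.carrier, h x = s ∨ h x = s' := by
  have := A.finite
  have : LocallyCompactSpace M := Manifold.locallyCompact_of_finiteDimensional (𝓡 N)
  let κ := {x : Σ _ : A.ι, ℝ // x.2 ∈ A.dom x.1 ∧ A.c x.1 x.2 = p}
  have hκ : Finite κ := A.finite_fiber_sigma p
  obtain ⟨ε, ⟨hεD, hεsep⟩, hε⟩ : ∃ ε : ℝ,
      ((∀ x : κ, MapsTo (A.c x.1.1) (A.dom x.1.1 ∩ Icc (x.1.2 - ε) (x.1.2 + ε)) D) ∧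
        ∀ x y : κ, x.1.2 ≠ y.1.2 → 2 * ε < |x.1.2 - y.1.2|) ∧ 0 < ε := by
    have h1 : ∀ᶠ ε in 𝓝[>] (0 : ℝ), ∀ x : κ,
        MapsTo (A.c x.1.1) (A.dom x.1.1 ∩ Icc (x.1.2 - ε) (x.1.2 + ε)) D :=
      eventually_all.2 fun x => H.exists_Icc x.2.1 (x.2.2.symm ▸ hpD)
    have h2 : ∀ᶠ ε in 𝓝[>] (0 : ℝ), ∀ x y : κ, x.1.2 ≠ y.1.2 → 2 * ε < |x.1.2 - y.1.2| := by
      refine eventually_all.2 fun x => eventually_all.2 fun y => ?_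
      by_cases hxy : x.1.2 = y.1.2
      · simp [hxy]
      · have h3 : 0 < |x.1.2 - y.1.2| := abs_pos.2 (sub_ne_zero.2 hxy)
        filter_upwards [Ioo_mem_nhdsGT (half_pos h3)] with ε hε _
        linarith [hε.2]
    exact ((h1.and h2).and self_mem_nhdsWithin).exists
  -- The germs at p: one passage of an arc through p together with a side, cut off at parameter
  -- distance ε.
  let Γ : κ × Bool → Set M := fun g =>
    A.c g.1.1.1 '' (A.dom g.1.1.1 ∩ bif g.2 then Ioo g.1.1.2 (g.1.1.2 + ε)
      else Ioo (g.1.1.2 - ε) g.1.1.2)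
  -- The first kind of predicate serves the intersection condition of a tassel, the second the
  -- condition on types.
  let P : (κ × Bool) × (κ × Bool) ⊕ Set (κ × Bool) → M → Prop := Sum.elim
    (fun g x => x ∈ Γ g.1 ∩ Γ g.2)
    (fun S x => x ≠ p ∧ x ∈ A.carrier ∧ IsLocArc N A.carrier x ∧ ∀ g, x ∈ Γ g ↔ g ∈ S)
  have hfib : ∀ i, ∀ᶠ x in 𝓝 p, ∀ t ∈ A.dom i, A.c i t = x →
      t ∈ {t | ∃ t₀ ∈ A.dom i, A.c i t₀ = p ∧ |t - t₀| < ε} := by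
    refine fun i => A.eventually_mem_of_fiber fun t ht htp => ?_
    filter_upwards [Metric.ball_mem_nhds t hε] with w hw
    exact ⟨t, ht, htp, hw⟩
  have hend : ∀ q : M, ∀ᶠ x in 𝓝 p, x = q → q = p := by
    intro q
    by_cases hq : q = p
    · exact .of_forall fun _ _ => hq
    · filter_upwards [isOpen_ne.mem_nhds (Ne.symm hq)] with x hx hxq
      exact absurd hxq hx
  obtain ⟨C, hC, hCcl, hCsub⟩ := exists_mem_nhds_isClosed_subset
    (((((eventually_imp_frequently p P).and (eventually_all.2 hfib)).and
      (eventually_all.2 fun i => hend (A.c i (A.a i)))).and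
      (eventually_all.2 fun i => hend (A.c i (A.b i)))).and
      (inter_mem hΩ (H.isOpen.mem_nhds hpD)))
  have hCfib : ∀ i, ∀ t ∈ A.dom i, A.c i t ∈ C → ∃ t₀ ∈ A.dom i, A.c i t₀ = p ∧ |t - t₀| < ε :=
    fun i t ht htC => (hCsub htC).1.1.1.2 i t ht rfl
  have hclK : closure (interior C) ⊆ C := hCcl.closure_subset_iff.2 interior_subset
  have hKD : closure (interior C) ∩ A.carrier ⊆ D := fun x hx => (hCsub (hclK hx.1)).2.2
  have hinj : ∀ x : κ, InjOn (h ∘ A.c x.1.1) (A.dom x.1.1 ∩ Icc (x.1.2 - ε) (x.1.2 + ε)) := by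
    intro x
    have h1 := hεD x
    have h2 : A.dom x.1.1 ∩ Icc (x.1.2 - ε) (x.1.2 + ε) ⊆ A.dom x.1.1 := inter_subset_left
    rw [ArcSystem.dom, Icc_inter_Icc] at *
    exact H.injOn h2 h1
  have hlevel : ∀ x ∈ closure (interior C) ∩ A.carrier, h x = h p → x = p := by
    rintro x ⟨hxC, hxA⟩ hxp
    obtain ⟨i, t, ht, rfl⟩ := ArcSystem.mem_carrier.1 hxA
    obtain ⟨t₀, ht₀, ht₀p, htt⟩ := hCfib i t ht (hclK hxC)
    rw [abs_lt] at htt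
    have : t = t₀ := hinj ⟨⟨i, t₀⟩, ht₀, ht₀p⟩ ⟨ht, by constructor <;> linarith⟩
      ⟨ht₀, by constructor <;> linarith⟩ (by simp [hxp, ht₀p])
    rw [this, ht₀p]
  have hpK : p ∈ interior C := mem_interior_iff_mem_nhds.2 hC
  -- The carrier crosses the frontier of K only at heights at least δ away from h p, so within a
  -- thinner slab arcs can leave only through the bounding levels.
  obtain ⟨δ, hδ, hgap⟩ := H.exists_gap (K := frontier (interior C)) isClosed_frontier
    (fun x hx => hKD ⟨frontier_subset_closure hx.1, hx.2⟩) (s := h p) (fun x hx hxp => by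
      have := hlevel x ⟨frontier_subset_closure hx.1, hx.2⟩ hxp
      subst this
      exact hx.1.2 (by rwa [interior_interior]))
  refine ⟨interior C, δ, hδ, isOpen_interior, hpK, fun x hx => (hCsub (hclK hx)).2, ?_⟩
  intro s hs s' hs'
  have hO : IsOpen (interior C ∩ h ⁻¹' Ioo s s') :=
    (H.continuousOn.mono fun x hx => (hCsub (interior_subset hx)).2.2).isOpen_inter_preimage
      isOpen_interior isOpen_Ioo
  have hclO : ∀ x ∈ closure (interior C ∩ h ⁻¹' Ioo s s') ∩ A.carrier,
      x ∈ interior C ∧ h x ∈ Icc s s' := by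
    rintro x ⟨hx, hxA⟩
    have hxK := closure_mono inter_subset_left hx
    have hxI : h x ∈ Icc s s' :=
      H.mem_Icc_of_mem_closure (hKD ⟨hxK, hxA⟩) (closure_mono inter_subset_right hx)
    exact ⟨mem_of_mem_closure_of_gap isOpen_interior hgap hxK hxA
      ⟨hs.1.trans_le hxI.1, hxI.2.trans_lt hs'.2⟩, hxI⟩
  have hbdry : ∀ x ∈ closure (interior C ∩ h ⁻¹' Ioo s s') ∩ A.carrier,
      x ∉ interior C ∩ h ⁻¹' Ioo s s' → h x = s ∨ h x = s' := by
    rintro x hx hxO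
    obtain ⟨hxK, hxI⟩ := hclO x hx
    by_contra! hne
    exact hxO ⟨hxK, lt_of_le_of_ne hxI.1 hne.1.symm, lt_of_le_of_ne hxI.2 hne.2⟩
  have hpre : IsPreCell A (interior C ∩ h ⁻¹' Ioo s s') p D h s s' :=
    { isHeight := H
      isOpen := hO
      mem := ⟨hpK, hs.2, hs'.1⟩
      mem_carrier := hpA
      closure_subset := fun x hx => hKD ⟨closure_mono inter_subset_left hx.1, hx.2⟩
      lt_left := hs.2
      lt_right := hs'.1
      level := fun x hx => hlevel x ⟨closure_mono inter_subset_left hx.1, hx.2⟩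
      levels := fun x hx => hx.1.2
      boundary := hbdry
      endpoint := fun i => ⟨fun hi => (hCsub (interior_subset hi.1)).1.1.2 i rfl,
        fun hi => (hCsub (interior_subset hi.1)).1.2 i rfl⟩ }
  -- Inside the cell each half arc coincides with a germ. It is no longer than ε, since passages are
  -- more than 2ε apart and every parameter mapped into C is within ε of one. Conversely, a germ
  -- running past the far end of the half arc has already passed a bounding level, and monotonicity
  -- keeps it from returning to the cell.
  have hgerm : ∀ i u v, IsHalfArc A (interior C ∩ h ⁻¹' Ioo s s') p i u v →
      ∃ g, ∀ x ∈ interior C ∩ h ⁻¹' Ioo s s', x ∈ A.c i '' Ioo u v ↔ x ∈ Γ g := by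
    intro i u v ha
    have hIoo : ∀ t ∈ Ioo u v, ∃ t₀ ∈ A.dom i, A.c i t₀ = p ∧ |t - t₀| < ε := fun t ht =>
      hCfib i t (ha.subset (Ioo_subset_Icc_self ht)) (interior_subset (ha.mapsTo ht).1.1)
    have hlv : ∀ x ∈ interior C ∩ h ⁻¹' Ioo s s', ∀ w ∈ Icc u v, A.c i w ∉
        interior C ∩ h ⁻¹' Ioo s s' → h (A.c i w) ∉ uIcc (h p) (h x) := by
      intro x hx w hw hwO hmem
      have h1 : h (A.c i w) ∈ Ioo s s' := ordConnected_Ioo.uIcc_subset hpre.mem.2 hx.2 hmem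
      rcases hbdry _ (ha.mapsTo_closure hw) hwO with h2 | h2 <;> rw [h2] at h1
      · exact lt_irrefl _ h1.1
      · exact lt_irrefl _ h1.2
    have hulI := left_mem_Icc.2 ha.lt.le
    have hvrI := right_mem_Icc.2 ha.lt.le
    rcases ha.ends with ⟨hu, hv⟩ | ⟨hv, hu⟩
    · let k : κ := ⟨⟨i, u⟩, ha.subset hulI, hu⟩
      have hvε : v ≤ u + ε := by
        by_contra! hlt
        obtain ⟨t₀, ht₀, ht₀p, habs⟩ := hIoo (u + ε) ⟨by linarith, hlt⟩
        have h1 := hεsep k ⟨⟨i, t₀⟩, ht₀, ht₀p⟩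
        rw [abs_lt] at habs
        by_cases hne : u = t₀
        · subst hne
          linarith [habs.2]
        · have h2 : 2 * ε < |u - t₀| := h1 hne
          have h3 : |u - t₀| < 2 * ε := by rw [abs_lt]; constructor <;> linarith
          linarith
      refine ⟨(k, true), fun x hx => ⟨?_, ?_⟩⟩
      · rintro ⟨t, ht, rfl⟩
        exact ⟨t, ⟨ha.subset (Ioo_subset_Icc_self ht), ht.1, ht.2.trans_le hvε⟩, rfl⟩
      · rintro ⟨t, ⟨ht, hut : u < t, hut' : t < u + ε⟩, rfl⟩
        refine ⟨t, ⟨hut, ?_⟩, rfl⟩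
        by_contra! hvt
        have hsub : Icc u t ⊆ A.dom i := fun w hw => ⟨(ha.subset hulI).1.trans hw.1, hw.2.trans ht.2⟩
        have hmap : MapsTo (A.c i) (Icc u t) D := (hεD k).mono_left fun w hw =>
          ⟨hsub hw, by change u - ε ≤ w; linarith [hw.1], hw.2.trans hut'.le⟩
        exact hlv _ hx v hvrI hv (hu ▸ H.apply_mem_uIcc ⟨ha.lt.le, hvt⟩ hsub hmap)
    · let k : κ := ⟨⟨i, v⟩, ha.subset hvrI, hv⟩
      have hvε : v - ε ≤ u := by
        by_contra! hlt
        obtain ⟨t₀, ht₀, ht₀p, habs⟩ := hIoo (v - ε) ⟨hlt, by linarith⟩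
        have h1 := hεsep k ⟨⟨i, t₀⟩, ht₀, ht₀p⟩
        rw [abs_lt] at habs
        by_cases hne : v = t₀
        · subst hne
          linarith [habs.1]
        · have h2 : 2 * ε < |v - t₀| := h1 hne
          have h3 : |v - t₀| < 2 * ε := by rw [abs_lt]; constructor <;> linarith
          linarith
      refine ⟨(k, false), fun x hx => ⟨?_, ?_⟩⟩
      · rintro ⟨t, ht, rfl⟩
        exact ⟨t, ⟨ha.subset (Ioo_subset_Icc_self ht), hvε.trans_lt ht.1, ht.2⟩, rfl⟩
      · rintro ⟨t, ⟨ht, hut' : v - ε < t, hut : t < v⟩, rfl⟩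
        refine ⟨t, ⟨?_, hut⟩, rfl⟩
        by_contra! hvt
        have hsub : Icc t v ⊆ A.dom i := fun w hw => ⟨ht.1.trans hw.1, hw.2.trans (ha.subset hvrI).2⟩
        have hmap : MapsTo (A.c i) (Icc t v) D := (hεD k).mono_left fun w hw =>
          ⟨hsub hw, hut'.le.trans hw.1, by change w ≤ v + ε; linarith [hw.2]⟩
        have h1 := H.apply_mem_uIcc ⟨hvt, ha.lt.le⟩ hsub hmap
        rw [hv, uIcc_comm] at h1
        exact hlv _ hx u hulI hu h1
  refine ⟨⟨⟨D, h, s, s', hpre⟩, ?_, ?_⟩, fun x hx => hbdry x ⟨frontier_subset_closure hx.1, hx.2⟩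
    fun hxO => hx.1.2 (by rwa [hO.interior_eq])⟩
  · rintro i u v j u' v' ha ha' ⟨x, hx, hx'⟩
    obtain ⟨g, hg⟩ := hgerm i u v ha
    obtain ⟨g', hg'⟩ := hgerm j u' v' ha'
    have hxO := (ha.image_subset hx).1
    have := (hCsub (interior_subset hxO.1)).1.1.1.1 (.inl (g, g'))
      ⟨(hg x hxO).1 hx, (hg' x hxO).1 hx'⟩
    refine (this.and_eventually (hO.mem_nhds hpre.mem)).mono fun y hy => ?_
    exact ⟨(hg y hy.2).2 hy.1.1, (hg' y hy.2).2 hy.1.2⟩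
  · rintro x ⟨hxO, hxA⟩ hxp hxL
    have := (hCsub (interior_subset hxO.1)).1.1.1.1 (.inr {g | x ∈ Γ g})
      ⟨hxp, hxA, hxL, fun g => Iff.rfl⟩
    refine (this.and_eventually (hO.mem_nhds hpre.mem)).mono ?_
    rintro y ⟨⟨hyp, hyA, hyL, hyg⟩, hyO⟩
    refine ⟨⟨hyO, hyA⟩, hyp, hyL, fun i u v ha => ?_⟩
    obtain ⟨g, hg⟩ := hgerm i u v ha
    rw [hg x hxO, hg y hyO, hyg g]
    rfl

theorem IsHeight.frequently_lt_and_gt (H : IsHeight A D h) (hpD : p ∈ D) {i : A.ι} {t : ℝ}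
    (ht : t ∈ Ioo (A.a i) (A.b i)) (htp : A.c i t = p) :
    (∃ᶠ y in 𝓝 p, y ∈ A.carrier ∧ h p < h y) ∧ ∃ᶠ y in 𝓝 p, y ∈ A.carrier ∧ h y < h p := by
  subst htp
  have key : ∀ U ∈ 𝓝 (A.c i t), ∃ α β, h (A.c i t) ∈ Ioo α β ∧
      Ioo α β ⊆ h '' (U ∩ A.carrier) := by
    intro U hU
    obtain ⟨u, v, htuv, hsub⟩ := ArcSystem.exists_Icc_subset ht
      (((A.continuousOn i).continuousAt (Icc_mem_nhds ht.1 ht.2)).preimage_mem_nhds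
        (inter_mem hU (H.isOpen.mem_nhds hpD)))
    have himg := H.image_Ioo (htuv.1.trans htuv.2).le (fun w hw => (hsub hw).1)
      (fun w hw => (hsub hw).2.2)
    refine ⟨_, _, himg ▸ mem_image_of_mem h (mem_image_of_mem _ htuv), ?_⟩
    refine himg.symm.subset.trans (image_mono ?_)
    rintro _ ⟨w, hw, rfl⟩
    have := hsub (Ioo_subset_Icc_self hw)
    exact ⟨this.2.1, A.apply_mem this.1⟩
  constructor <;> rw [frequently_iff] <;> intro U hU <;>
    obtain ⟨α, β, ⟨hα, hβ⟩, hsub⟩ := key U hU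
  · obtain ⟨r, hr, hr'⟩ := exists_between hβ
    obtain ⟨y, ⟨hyU, hyA⟩, rfl⟩ := hsub ⟨hα.trans hr, hr'⟩
    exact ⟨y, hyU, hyA, hr⟩
  · obtain ⟨r, hr, hr'⟩ := exists_between hα
    obtain ⟨y, ⟨hyU, hyA⟩, rfl⟩ := hsub ⟨hr, hr'.trans hβ⟩
    exact ⟨y, hyU, hyA, hr'⟩

/-- Under injectivity every half arc is the whole part of the carrier above p or the whole part
below p, so only two patterns exist away from p. Some arc passes through p in its interior, and both
patterns recur there. -/
theorem IsPreCell.isCell_of_injOn [T2Space M] (hc : IsPreCell A O p D h s s') (hOD : O ⊆ D)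
    (hend : ∀ i, A.c i (A.a i) ∉ O ∧ A.c i (A.b i) ∉ O) (hinj : InjOn h (O ∩ A.carrier)) :
    IsCell A O p := by
  have hside : ∀ i u v, IsHalfArc A O p i u v →
      (∀ y ∈ O ∩ A.carrier, y ∈ A.c i '' Ioo u v ↔ h p < h y) ∨
      (∀ y ∈ O ∩ A.carrier, y ∈ A.c i '' Ioo u v ↔ h y < h p) := by
    intro i u v ha
    have hmem : ∀ y ∈ O ∩ A.carrier, y ∈ A.c i '' Ioo u v ↔ h y ∈ h '' (A.c i '' Ioo u v) := by
      refine fun y hy => ⟨mem_image_of_mem h, ?_⟩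
      rintro ⟨z, hz, hzy⟩
      rwa [← hinj (ha.image_subset hz) hy hzy]
    rcases hc.image_halfArc ha with himg | himg
    · exact .inl fun y hy => by
        rw [hmem y hy, himg]
        exact ⟨fun h' => h'.1, fun h' => ⟨h', (hc.levels y hy).2⟩⟩
    · exact .inr fun y hy => by
        rw [hmem y hy, himg]
        exact ⟨fun h' => h'.2, fun h' => ⟨(hc.levels y hy).1, h'⟩⟩
  obtain ⟨k, t, ht, htp⟩ := ArcSystem.mem_carrier.1 hc.mem_carrier
  obtain ⟨hgt, hlt⟩ := hc.isHeight.frequently_lt_and_gt (hOD hc.mem)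
    (ArcSystem.mem_Ioo ht (htp ▸ hc.mem) hend) htp
  have hO := hc.isOpen.mem_nhds hc.mem
  refine ⟨⟨D, h, s, s', hc⟩, ?_, ?_⟩
  · rintro i u v j u' v' ha ha' ⟨x, hx, hx'⟩
    have hxO := ha.image_subset hx
    rcases hside i u v ha with h1 | h1 <;> rcases hside j u' v' ha' with h2 | h2
    · exact (hgt.and_eventually hO).mono fun y hy =>
        ⟨(h1 y ⟨hy.2, hy.1.1⟩).2 hy.1.2, (h2 y ⟨hy.2, hy.1.1⟩).2 hy.1.2⟩
    · exact absurd ((h1 x hxO).1 hx) (not_lt.2 ((h2 x hxO).1 hx').le)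
    · exact absurd ((h1 x hxO).1 hx) (not_lt.2 ((h2 x hxO).1 hx').le)
    · exact (hlt.and_eventually hO).mono fun y hy =>
        ⟨(h1 y ⟨hy.2, hy.1.1⟩).2 hy.1.2, (h2 y ⟨hy.2, hy.1.1⟩).2 hy.1.2⟩
  · rintro x hx hxp -
    have hne : h x ≠ h p := fun he => hxp (hc.level x ⟨subset_closure hx.1, hx.2⟩ he)
    rcases lt_or_gt_of_ne hne with hx' | hx'
    · refine (hlt.and_eventually hO).mono fun y hy => ⟨⟨hy.2, hy.1.1⟩, ?_,
        hc.isHeight.isLocArc_of_injOn hc.isOpen hOD hend hinj hy.2 hy.1.1, fun i u v ha => ?_⟩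
      · rintro rfl
        exact lt_irrefl _ hy.1.2
      · rcases hside i u v ha with h1 | h1 <;> rw [h1 x hx, h1 y ⟨hy.2, hy.1.1⟩]
        · exact ⟨fun h' => absurd h' (not_lt.2 hx'.le), fun h' => absurd h' (not_lt.2 hy.1.2.le)⟩
        · exact ⟨fun _ => hy.1.2, fun _ => hx'⟩
    · refine (hgt.and_eventually hO).mono fun y hy => ⟨⟨hy.2, hy.1.1⟩, ?_,
        hc.isHeight.isLocArc_of_injOn hc.isOpen hOD hend hinj hy.2 hy.1.1, fun i u v ha => ?_⟩
      · rintro rfl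
        exact lt_irrefl _ hy.1.2
      · rcases hside i u v ha with h1 | h1 <;> rw [h1 x hx, h1 y ⟨hy.2, hy.1.1⟩]
        · exact ⟨fun _ => hy.1.2, fun _ => hx'⟩
        · exact ⟨fun h' => absurd h' (not_lt.2 hx'.le), fun h' => absurd h' (not_lt.2 hy.1.2.le)⟩

end Cells

/-! ### Decomposition into disjoint cells -/

section Webbable

open Filter

variable {N : ℕ} {M : Type*} [TopologicalSpace M] [ChartedSpace (EuclideanSpace ℝ (Fin N)) M]

/-- A finite set of nice points. -/
def IsCutSet (A : ArcSystem N M) (S : Set M) : Prop := S.Finite ∧ ∀ x ∈ S, A.IsNice x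

/-- Up to finitely many nice points, the part of the arcs in `V` lies in finitely many disjoint
cells. -/
def IsWebbable (A : ArcSystem N M) (V : Set M) : Prop :=
  ∃ 𝒪 : Set (Set M × M), 𝒪.Finite ∧ (∀ o ∈ 𝒪, IsCell A o.1 o.2 ∧ o.1 ⊆ V) ∧
    𝒪.PairwiseDisjoint Prod.fst ∧ IsCutSet A ((V ∩ A.carrier) \ ⋃ o ∈ 𝒪, o.1)

variable {A : ArcSystem N M} {O V : Set M} {p : M} {D : Set M} {h : M → ℝ} {s s' : ℝ}

theorem IsCutSet.mono {S T : Set M} (hT : IsCutSet A T) (hST : S ⊆ T) : IsCutSet A S :=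
  ⟨hT.1.subset hST, fun x hx => hT.2 x (hST hx)⟩

theorem IsCutSet.union {S T : Set M} (hS : IsCutSet A S) (hT : IsCutSet A T) :
    IsCutSet A (S ∪ T) :=
  ⟨hS.1.union hT.1, fun x hx => hx.elim (hS.2 x) (hT.2 x)⟩

theorem isCutSet_empty : IsCutSet A ∅ := ⟨finite_empty, fun _ hx => hx.elim⟩

theorem isCutSet_iUnion {κ : Type*} [Finite κ] {S : κ → Set M} (hS : ∀ k, IsCutSet A (S k)) :
    IsCutSet A (⋃ k, S k) := by
  refine ⟨finite_iUnion fun k => (hS k).1, fun x hx => ?_⟩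
  obtain ⟨k, hk⟩ := mem_iUnion.1 hx
  exact (hS k).2 x hk

theorem IsWebbable.iUnion {κ : Type*} [Finite κ] {V : κ → Set M} {W : Set M}
    (hsub : ∀ k, V k ⊆ W) (hdisj : Pairwise (Function.onFun Disjoint V))
    (hV : ∀ k, IsWebbable A (V k)) (hcut : IsCutSet A ((W ∩ A.carrier) \ ⋃ k, V k)) :
    IsWebbable A W := by
  choose 𝒪 hfin hcell hpd hrem using hV
  refine ⟨⋃ k, 𝒪 k, finite_iUnion hfin, ?_, ?_, ?_⟩
  · intro o ho
    obtain ⟨k, hk⟩ := mem_iUnion.1 ho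
    exact ⟨(hcell k o hk).1, (hcell k o hk).2.trans (hsub k)⟩
  · intro o ho o' ho' hne
    obtain ⟨k, hk⟩ := mem_iUnion.1 ho
    obtain ⟨k', hk'⟩ := mem_iUnion.1 ho'
    by_cases hkk : k = k'
    · subst hkk
      exact hpd k hk hk' hne
    · exact (hdisj hkk).mono (hcell k o hk).2 (hcell k' o' hk').2
  · refine (hcut.union (isCutSet_iUnion hrem)).mono ?_
    rintro x ⟨⟨hxW, hxA⟩, hx⟩
    by_cases hxV : x ∈ ⋃ k, V k
    · obtain ⟨k, hk⟩ := mem_iUnion.1 hxV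
      refine .inr (mem_iUnion.2 ⟨k, ⟨hk, hxA⟩, fun hx' => hx ?_⟩)
      obtain ⟨o, ho, hxo⟩ := mem_iUnion₂.1 hx'
      exact mem_iUnion₂.2 ⟨o, mem_iUnion.2 ⟨k, ho⟩, hxo⟩
    · exact .inl ⟨⟨hxW, hxA⟩, hxV⟩

theorem IsWebbable.union {V₁ V₂ W : Set M} (h₁ : V₁ ⊆ W) (h₂ : V₂ ⊆ W) (hdisj : Disjoint V₁ V₂)
    (hV₁ : IsWebbable A V₁) (hV₂ : IsWebbable A V₂)
    (hcut : IsCutSet A ((W ∩ A.carrier) \ (V₁ ∪ V₂))) : IsWebbable A W := by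
  refine IsWebbable.iUnion (κ := Bool) (V := fun k => cond k V₁ V₂) ?_ ?_ ?_ ?_
  · rintro (_ | _) <;> assumption
  · rintro (_ | _) (_ | _) hne
    · exact absurd rfl hne
    · exact hdisj.symm
    · exact hdisj
    · exact absurd rfl hne
  · rintro (_ | _) <;> assumption
  · rwa [← union_eq_iUnion]

theorem IsWebbable.mono_of_carrier_subset {W : Set M} (hV : IsWebbable A V) (hVW : V ⊆ W)
    (hWV : W ∩ A.carrier ⊆ V) : IsWebbable A W :=
  IsWebbable.iUnion (κ := Unit) (fun _ => hVW) (fun _ _ hne => absurd rfl hne) (fun _ => hV) (by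
    rw [iUnion_const, sdiff_eq_empty.2 hWV]
    exact isCutSet_empty)

theorem isWebbable_of_carrier_inter_eq_empty (hV : V ∩ A.carrier = ∅) : IsWebbable A V :=
  ⟨∅, finite_empty, fun _ ho => ho.elim, pairwiseDisjoint_empty, by
    simpa [hV] using isCutSet_empty⟩

theorem IsCell.isWebbable (hO : IsCell A O p) : IsWebbable A O :=
  ⟨{(O, p)}, finite_singleton _, by simpa using hO, pairwiseDisjoint_singleton _ _, by
    refine (isCutSet_empty (A := A)).mono fun x hx => hx.2 ?_
    simpa using hx.1.1⟩

/-- A point of V has a cell inside V. At a frontier point, niceness makes the height injective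
nearby, and the parts of V above and below it are treated separately. -/
theorem IsHeight.exists_isWebbable_slab_nhds [T2Space M] [IsManifold (𝓡 N) ∞ M]
    (H : IsHeight A D h) (hV : IsOpen V) (hVD : closure V ⊆ D)
    (hcut : IsCutSet A (frontier V ∩ A.carrier)) (hp : p ∈ closure V) (hpA : p ∈ A.carrier)
    {Ω : Set M} (hΩ : Ω ∈ 𝓝 p) :
    ∃ K, ∃ δ > 0, IsOpen K ∧ p ∈ K ∧ K ⊆ Ω ∧ ∀ s ∈ Ioo (h p - δ) (h p),
      ∀ s' ∈ Ioo (h p) (h p + δ), IsWebbable A (K ∩ V ∩ h ⁻¹' Ioo s s') := by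
  have : LocallyCompactSpace M := Manifold.locallyCompact_of_finiteDimensional (𝓡 N)
  by_cases hpV : p ∈ V
  · obtain ⟨K, δ, hδ, hK, hpK, hKsub, hcell⟩ :=
      ArcSystem.exists_cell H (hVD hp) hpA (inter_mem hΩ (hV.mem_nhds hpV))
    have hKsub' := subset_closure.trans hKsub
    refine ⟨K, δ, hδ, hK, hpK, fun x hx => (hKsub' hx).1.1, fun s hs s' hs' => ?_⟩
    rw [inter_eq_left.2 fun x hx => (hKsub' hx).1.2]
    exact (hcell s hs s' hs').1.isWebbable
  · have hpF : p ∈ frontier V ∩ A.carrier := ⟨⟨hp, by rwa [hV.interior_eq]⟩, hpA⟩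
    obtain ⟨Q, hQ, hpQ, hQD, hend, hinj⟩ := hcut.2 p hpF D h H (hVD hp)
    obtain ⟨C, hC, hCcl, hCsub⟩ := exists_mem_nhds_isClosed_subset
      (inter_mem (inter_mem hΩ (hQ.mem_nhds hpQ))
        ((hcut.1.subset (sdiff_subset (s := frontier V ∩ A.carrier)
          (t := {p}))).isClosed.isOpen_compl.mem_nhds fun hx => hx.2 rfl))
    have hclK : closure (interior C) ⊆ C := hCcl.closure_subset_iff.2 interior_subset
    have hCQ : ∀ x ∈ C, x ∈ Q := fun x hx => (hCsub hx).1.2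
    have hpK : p ∈ interior C := mem_interior_iff_mem_nhds.2 hC
    obtain ⟨δ, hδ, hgap⟩ := H.exists_gap (A := A) (K := frontier (interior C)) isClosed_frontier
      (fun x hx => hQD (hCQ x (hclK (frontier_subset_closure hx.1)))) (s := h p)
      (fun x hx hxp => by
        have := hinj ⟨hCQ x (hclK (frontier_subset_closure hx.1)), hx.2⟩ ⟨hpQ, hpA⟩ hxp
        subst this
        exact hx.1.2 (by rwa [interior_interior]))
    -- A slab avoiding the level of p avoids the only nearby point of the carrier on the frontier of
    -- V. What remains misses the carrier or is a cell based at any of its points.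
    have hside : ∀ α β, h p - δ < α → β < h p + δ → h p ∉ Ioo α β →
        IsWebbable A (interior C ∩ V ∩ h ⁻¹' Ioo α β) := by
      intro α β hα hβ hpαβ
      set O := interior C ∩ V ∩ h ⁻¹' Ioo α β
      rcases (O ∩ A.carrier).eq_empty_or_nonempty with he | ⟨x, hxO, hxA⟩
      · exact isWebbable_of_carrier_inter_eq_empty he
      · have hOQ : O ⊆ Q := fun y hy => hCQ y (interior_subset hy.1.1)
        have hclC : closure O ⊆ C :=
          (closure_mono fun y (hy : y ∈ O) => hy.1.1).trans hclK
        have hclV : closure O ⊆ closure V := closure_mono fun y (hy : y ∈ O) => hy.1.2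
        have hO : IsOpen O := (H.continuousOn.mono fun y (hy : y ∈ interior C ∩ V) =>
          hQD (hCQ y (interior_subset hy.1))).isOpen_inter_preimage
            (isOpen_interior.inter hV) isOpen_Ioo
        refine (IsPreCell.isCell_of_injOn (p := x) (D := D) (h := h) (s := α) (s' := β) ?_
          (hOQ.trans hQD) (fun i => ⟨fun hi => (hend i).1 (hOQ hi), fun hi => (hend i).2 (hOQ hi)⟩)
          (hinj.mono (inter_subset_inter_left _ hOQ))).isWebbable
        refine
          { isHeight := H
            isOpen := hO
            mem := hxO
            mem_carrier := hxA
            closure_subset := fun y hy => hQD (hCQ y (hclC hy.1))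
            lt_left := hxO.2.1
            lt_right := hxO.2.2
            level := fun y hy hyx => hinj ⟨hCQ y (hclC hy.1), hy.2⟩ ⟨hOQ hxO, hxA⟩ hyx
            levels := fun y hy => hy.1.2
            boundary := ?_
            endpoint := fun i =>
              ⟨fun hi => absurd (hOQ hi) (hend i).1, fun hi => absurd (hOQ hi) (hend i).2⟩ }
        rintro y ⟨hy, hyA⟩ hyO
        have hyI : h y ∈ Icc α β := H.mem_Icc_of_mem_closure (hQD (hCQ y (hclC hy)))
          (closure_mono inter_subset_right hy)
        have hyK : y ∈ interior C := mem_of_mem_closure_of_gap isOpen_interior hgap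
          (closure_mono (fun z (hz : z ∈ O) => hz.1.1) hy) hyA
          ⟨hα.trans_le hyI.1, hyI.2.trans_lt hβ⟩
        have hnI : h y ∉ Ioo α β := by
          intro hyI'
          by_cases hyV : y ∈ V
          · exact hyO ⟨⟨hyK, hyV⟩, hyI'⟩
          · have hyF : y ∈ frontier V ∩ A.carrier := ⟨⟨hclV hy, by rwa [hV.interior_eq]⟩, hyA⟩
            have : y = p := by
              by_contra hne
              exact (hCsub (hclC hy)).2 ⟨hyF, hne⟩
            exact hpαβ (this ▸ hyI')
        by_contra! hne
        exact hnI ⟨lt_of_le_of_ne hyI.1 hne.1.symm, lt_of_le_of_ne hyI.2 hne.2⟩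
    refine ⟨interior C, δ, hδ, isOpen_interior, hpK,
      fun x hx => (hCsub (interior_subset hx)).1.1, fun s hs s' hs' => ?_⟩
    refine IsWebbable.union (V₁ := interior C ∩ V ∩ h ⁻¹' Ioo s (h p))
      (V₂ := interior C ∩ V ∩ h ⁻¹' Ioo (h p) s')
      (inter_subset_inter_right _ (preimage_mono (Ioo_subset_Ioo_right hs'.1.le)))
      (inter_subset_inter_right _ (preimage_mono (Ioo_subset_Ioo_left hs.2.le)))
      (disjoint_left.2 fun x hx hx' => lt_asymm hx.2.2 hx'.2.1)
      (hside _ _ hs.1 (by linarith) fun hx => lt_irrefl _ hx.2)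
      (hside _ _ (by linarith) hs'.2 fun hx => lt_irrefl _ hx.1) ?_
    refine isCutSet_empty.mono ?_
    rintro x ⟨⟨⟨⟨hxC, hxV⟩, hxI⟩, hxA⟩, hx⟩
    rcases lt_trichotomy (h x) (h p) with hlt | heq | hgt
    · exact hx (.inl ⟨⟨hxC, hxV⟩, hxI.1, hlt⟩)
    · have := hinj ⟨hCQ x (interior_subset hxC), hxA⟩ ⟨hpQ, hpA⟩ heq
      exact hpV (this ▸ hxV)
    · exact hx (.inr ⟨⟨hxC, hxV⟩, hgt, hxI.2⟩)

theorem IsHeight.dense_nice_levels [T2Space M] [IsManifold (𝓡 N) ∞ M] (H : IsHeight A D h) :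
    Dense {s | ∀ x ∈ D ∩ A.carrier, h x = s → A.IsNice x} := by
  refine (dense_of_mem_residual H.isMeagre_levels).mono fun s hs x hx hxs => ?_
  by_contra hn
  exact hs ⟨x, hx, hn, hxs⟩

/-- A level meets the closure of V in finitely many points of the carrier, and a thin slab has
carrier only near these. Adjacent slabs are joined at nice levels until all heights of the compact
set are covered. -/
theorem IsHeight.isWebbable [T2Space M] [IsManifold (𝓡 N) ∞ M] (H : IsHeight A D h)
    (hV : IsOpen V) (hVD : closure V ⊆ D) (hcut : IsCutSet A (frontier V ∩ A.carrier)) :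
    IsWebbable A V := by
  have hVD' : closure V ∩ A.carrier ⊆ D := inter_subset_left.trans hVD
  obtain ⟨B, hB⟩ := (A.isCompact_carrier.inter_left
    (isClosed_closure (s := V))).exists_bound_of_continuousOn (H.continuousOn.mono hVD')
  -- If the compact set is empty the bound B may be negative; the maximum with 0 keeps the interval
  -- to be covered well formed.
  obtain ⟨s, s', hs, hs', hR⟩ : ∃ s s', s < -max B 0 ∧ max B 0 < s' ∧
      IsWebbable A (V ∩ h ⁻¹' Ioo s s') := by
    refine exists_interval_of_locally H.dense_nice_levels
      (R := fun s s' => IsWebbable A (V ∩ h ⁻¹' Ioo s s')) ?_ ?_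
      (by linarith [le_max_right B 0])
    · intro x hx y hy z hz hxy hyz h1 h2
      refine IsWebbable.union (inter_subset_inter_right _ (preimage_mono
        (Ioo_subset_Ioo_right hyz.le))) (inter_subset_inter_right _ (preimage_mono
        (Ioo_subset_Ioo_left hxy.le))) (disjoint_left.2 fun q hq hq' => lt_asymm hq.2.2 hq'.2.1)
        h1 h2 (IsCutSet.mono (T := {q | q ∈ closure V ∩ A.carrier ∧ h q = y})
          ⟨H.finite_level isClosed_closure hVD' y, fun q hq => hy q ⟨hVD' hq.1, hq.1.2⟩ hq.2⟩ ?_)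
      rintro q ⟨⟨⟨hqV, hqI⟩, hqA⟩, hq⟩
      refine ⟨⟨subset_closure hqV, hqA⟩, ?_⟩
      by_contra hne
      rcases lt_or_gt_of_ne hne with hlt | hgt
      · exact hq (.inl ⟨hqV, hqI.1, hlt⟩)
      · exact hq (.inr ⟨hqV, hgt, hqI.2⟩)
    · intro σ
      set L := {x | x ∈ closure V ∩ A.carrier ∧ h x = σ}
      have hL : L.Finite := H.finite_level isClosed_closure hVD' σ
      have : Finite L := hL.to_subtype
      obtain ⟨U, hU, hUd⟩ := hL.t2_separation
      choose K δ hδ hK hpK hKU hKw using fun p : L => H.exists_isWebbable_slab_nhds hV hVD hcut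
        p.2.1.1 p.2.1.2 ((hU p).2.mem_nhds (hU p).1)
      have hKo : IsOpen (⋃ p, K p) := isOpen_iUnion hK
      obtain ⟨δ₀, hδ₀, hgap⟩ := H.exists_gap (A := A) (K := closure V \ ⋃ p, K p)
        (isClosed_closure.sdiff hKo) (fun x hx => hVD hx.1.1) (s := σ)
        (fun x hx hxσ => hx.1.2 (mem_iUnion.2 ⟨⟨x, ⟨hx.1.1, hx.2⟩, hxσ⟩, hpK _⟩))
      obtain ⟨ε, ⟨hε, hε₀⟩, hεpos⟩ : ∃ ε, ((∀ p, ε < δ p) ∧ ε < δ₀) ∧ 0 < ε := by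
        have h1 : ∀ᶠ ε in 𝓝[>] (0 : ℝ), ∀ p, ε < δ p :=
          eventually_all.2 fun p => mem_of_superset (Ioo_mem_nhdsGT (hδ p)) fun ε hε => hε.2
        have h2 : ∀ᶠ ε in 𝓝[>] (0 : ℝ), ε < δ₀ :=
          mem_of_superset (Ioo_mem_nhdsGT hδ₀) fun ε hε => hε.2
        exact ((h1.and h2).and self_mem_nhdsWithin).exists
      refine ⟨ε, hεpos, fun s _ s' _ hs hs' => ?_⟩
      refine IsWebbable.iUnion (V := fun p : L => K p ∩ V ∩ h ⁻¹' Ioo s s')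
        (fun p x hx => ⟨hx.1.2, hx.2⟩) ?_ ?_ ?_
      · intro p q hne
        exact (hUd p.2 q.2 (Subtype.coe_ne_coe.2 hne)).mono (fun x hx => hKU p hx.1.1)
          fun x hx => hKU q hx.1.1
      · intro p
        refine hKw p s ?_ s' ?_ <;> rw [p.2.2]
        · exact ⟨by linarith [hs.1, hε p], hs.2⟩
        · exact ⟨hs'.1, by linarith [hs'.2, hε p]⟩
      · refine isCutSet_empty.mono ?_
        rintro x ⟨⟨⟨hxV, hxI⟩, hxA⟩, hx⟩
        have hxK : x ∉ ⋃ p, K p := fun hxK => by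
          obtain ⟨p, hp⟩ := mem_iUnion.1 hxK
          exact hx (mem_iUnion.2 ⟨p, ⟨hp, hxV⟩, hxI⟩)
        exact hgap x ⟨⟨subset_closure hxV, hxK⟩, hxA⟩
          ⟨by linarith [hs.1, hxI.1], by linarith [hs'.2, hxI.2]⟩
  refine hR.mono_of_carrier_subset inter_subset_left fun x hx => ⟨hx.1, ?_⟩
  have := abs_le.1 (hB x ⟨subset_closure hx.1, hx.2⟩)
  constructor <;> linarith [le_max_left B 0]

/-- A cell between two nice levels works: arcs meet its frontier only on these levels. -/
theorem ArcSystem.exists_isOpen_isCutSet_frontier [T2Space M] [IsManifold (𝓡 N) ∞ M]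
    (hp : p ∈ A.carrier) : ∃ B D h, IsOpen B ∧ p ∈ B ∧ IsHeight A D h ∧ closure B ⊆ D ∧
      IsCutSet A (frontier B ∩ A.carrier) := by
  obtain ⟨D, h, H, hpD⟩ := A.exists_isHeight p
  obtain ⟨K, δ, hδ, hK, hpK, hKsub, hcell⟩ := A.exists_cell H hpD hp univ_mem
  obtain ⟨s, hsG, hs⟩ := H.dense_nice_levels.exists_between (show h p - δ < h p by linarith)
  obtain ⟨s', hsG', hs'⟩ := H.dense_nice_levels.exists_between (show h p < h p + δ by linarith)
  obtain ⟨hc, hb⟩ := hcell s hs s' hs'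
  have hcl : closure (K ∩ h ⁻¹' Ioo s s') ⊆ D :=
    (closure_mono inter_subset_left).trans (hKsub.trans inter_subset_right)
  obtain ⟨_, _, _, _, hpre⟩ := hc.pre
  have hlev : ∀ r ∈ {s | ∀ x ∈ D ∩ A.carrier, h x = s → A.IsNice x}, IsCutSet A
      {x | x ∈ closure (K ∩ h ⁻¹' Ioo s s') ∩ A.carrier ∧ h x = r} := fun r hr =>
    ⟨H.finite_level isClosed_closure (inter_subset_left.trans hcl) r,
      fun x hx => hr x ⟨hcl hx.1.1, hx.1.2⟩ hx.2⟩
  refine ⟨K ∩ h ⁻¹' Ioo s s', D, h, hpre.isOpen, hpre.mem, H, hcl,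
    ((hlev s hsG).union (hlev s' hsG')).mono fun x hx => ?_⟩
  exact (hb x hx).imp (fun h' => ⟨⟨frontier_subset_closure hx.1, hx.2⟩, h'⟩)
    fun h' => ⟨⟨frontier_subset_closure hx.1, hx.2⟩, h'⟩

/-- Each new set B of a finite cover contributes only its part outside the closure of the union U so
far. Frontiers stay in the old ones, and the part of B ∪ U left uncovered lies on the frontier of U.
-/
theorem ArcSystem.isWebbable_univ [T2Space M] [IsManifold (𝓡 N) ∞ M] (A : ArcSystem N M) :
    IsWebbable A univ := by
  choose! B D h hB hpB H hBD hcut using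
    fun (p : M) (hp : p ∈ A.carrier) => A.exists_isOpen_isCutSet_frontier hp
  obtain ⟨F, hF, hcover⟩ := A.isCompact_carrier.elim_nhds_subcover B
    fun p hp => (hB p hp).mem_nhds (hpB p hp)
  have key : ∀ F : Finset M, (∀ p ∈ F, p ∈ A.carrier) → IsOpen (⋃ p ∈ F, B p) ∧
      IsCutSet A (frontier (⋃ p ∈ F, B p) ∩ A.carrier) ∧ IsWebbable A (⋃ p ∈ F, B p) := by
    intro F
    classical
    induction F using Finset.induction_on with
    | empty =>
      intro _
      simpa using ⟨isCutSet_empty, isWebbable_of_carrier_inter_eq_empty (empty_inter A.carrier)⟩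
    | insert p F _ ih =>
      intro hF
      obtain ⟨hU, hUcut, hUw⟩ := ih fun q hq => hF q (Finset.mem_insert_of_mem hq)
      have hp := hF p (Finset.mem_insert_self p F)
      rw [Finset.set_biUnion_insert]
      set U := ⋃ q ∈ F, B q
      have hfr : ∀ x ∈ closure U, x ∉ U → x ∈ frontier U := fun x hx hxU =>
        ⟨hx, by rwa [hU.interior_eq]⟩
      have hVfr : frontier (B p \ closure U) ⊆ frontier (B p) ∪ frontier U := by
        rw [sdiff_eq]
        refine (frontier_inter_subset _ _).trans (union_subset_union inter_subset_left ?_)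
        rw [frontier_compl]
        exact inter_subset_right.trans frontier_closure_subset
      have hVw : IsWebbable A (B p \ closure U) :=
        (H p hp).isWebbable ((hB p hp).sdiff isClosed_closure)
          ((closure_mono sdiff_subset).trans (hBD p hp))
          (((hcut p hp).union hUcut).mono (by
            rw [← union_inter_distrib_right]
            exact inter_subset_inter_left _ hVfr))
      refine ⟨(hB p hp).union hU, ((hcut p hp).union hUcut).mono ?_, ?_⟩
      · rw [← union_inter_distrib_right]
        exact inter_subset_inter_left _ ((frontier_union_subset _ _).trans
          (union_subset_union inter_subset_left inter_subset_right))
      · refine IsWebbable.union (V₁ := B p \ closure U) (V₂ := U)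
          (sdiff_subset.trans subset_union_left) subset_union_right
          (disjoint_left.2 fun x hx hxU => hx.2 (subset_closure hxU)) hVw hUw (hUcut.mono ?_)
        rintro x ⟨⟨hx, hxA⟩, hx'⟩
        have hxU : x ∉ U := fun h' => hx' (.inr h')
        refine ⟨hfr x ?_ hxU, hxA⟩
        by_contra hxc
        exact hx' (.inl ⟨hx.resolve_right hxU, hxc⟩)
  exact (key F hF).2.2.mono_of_carrier_subset (subset_univ _) fun x hx => hcover hx.2

end Webbable

/-! ### Height parametrizations and meetings at nice points -/

section Assembly

open Filter

variable {N : ℕ} {M : Type*} [TopologicalSpace M] [ChartedSpace (EuclideanSpace ℝ (Fin N)) M]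

theorem SmoothImmersionOn.comp_inverse {f : ℝ → M} {ψ : ℝ → ℝ} {u v c d : ℝ} (hcd : c < d)
    (hf : SmoothImmersionOn N f (Icc u v)) (hψ : ContDiffOn ℝ ∞ ψ (Icc c d))
    (hmaps : MapsTo ψ (Icc c d) (Icc u v)) (hd : ∀ r ∈ Icc c d, derivWithin ψ (Icc c d) r ≠ 0) :
    SmoothImmersionOn N (f ∘ ψ) (Icc c d) := by
  refine ⟨hf.1.comp (contMDiffOn_iff_contDiffOn.2 hψ) hmaps, fun r hr => ?_⟩
  rw [mfderivWithin_comp r ((hf.1 _ (hmaps hr)).mdifferentiableWithinAt (by simp))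
    (((contMDiffOn_iff_contDiffOn.2 hψ) r hr).mdifferentiableWithinAt (by simp)) hmaps
    (uniqueMDiffWithinAt_iff_uniqueDiffWithinAt.2 (uniqueDiffOn_Icc hcd r hr))]
  refine (hf.2 _ (hmaps hr)).comp ?_
  rw [mfderivWithin_eq_fderivWithin]
  have h1 := ((hψ r hr).differentiableWithinAt (by simp)).hasDerivWithinAt.hasFDerivWithinAt
  rw [h1.fderivWithin (uniqueDiffOn_Icc hcd r hr)]
  intro (x : ℝ) (y : ℝ) hxy
  have h2 : x * derivWithin ψ (Icc c d) r = y * derivWithin ψ (Icc c d) r := hxy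
  exact mul_right_cancel₀ (M₀ := ℝ) (hd r hr) h2

/-- A smoothly immersed curve. -/
def Curve.ofSmooth (f : ℝ → M) (a b : ℝ) (hab : a < b) (hf : SmoothImmersionOn N f (Icc a b)) :
    Curve N M where
  a := a
  b := b
  a_lt_b := hab
  toFun := f
  piecewise := ⟨1, ![a, b], by
    refine ⟨?_, rfl, rfl, fun k => ?_⟩
    · intro x y hxy
      fin_cases x <;> fin_cases y <;> simp_all
    · fin_cases k
      exact hf⟩

variable {A : ArcSystem N M} {O : Set M} {p : M} {D : Set M} {h : M → ℝ} {s s' : ℝ}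

/-- The curve `S` runs along the half arc over `[u, v]` from `p`, parametrized by the height above
or below `p`. -/
structure IsHeightParam (A : ArcSystem N M) (O : Set M) (p : M) (h : M → ℝ) (i : A.ι) (u v : ℝ)
    (S : Curve N M) (e : ℝ) : Prop where
  sign : e = 1 ∨ e = -1
  left : S.a = 0
  apply_zero : S.toFun 0 = p
  apply_right : S.toFun S.b ∉ O
  image_Ioo : S.toFun '' Ioo 0 S.b = A.c i '' Ioo u v
  image_Icc : S.toFun '' Icc 0 S.b = A.c i '' Icc u v
  height : ∀ r ∈ Icc 0 S.b, h (S.toFun r) = h p + e * r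
  smooth : SmoothImmersionOn N S.toFun (Icc 0 S.b)
  reparam : ∀ g, EqOn g S.toFun (Icc S.a S.b) →
    PosReparam (A.c i) u v g S.a S.b ∨ NegReparam (A.c i) u v g S.a S.b

/-- The distance in height from p is a diffeomorphism from the parameters of a half arc onto some
[0, L], and its inverse is the reparametrization sought. The parameter then depends only on the
point reached, not on the half arc. -/
theorem IsPreCell.exists_isHeightParam (hc : IsPreCell A O p D h s s') {i : A.ι} {u v : ℝ}
    (ha : IsHalfArc A O p i u v) : ∃ S e, IsHeightParam A O p h i u v S e := by
  have H := hc.isHeight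
  have hD := hc.mapsTo_halfArc ha
  have hu := left_mem_Icc.2 ha.lt.le
  have hv := right_mem_Icc.2 ha.lt.le
  have hpos : ∀ x, x ∈ closure O ∩ A.carrier → x ∉ O →
      ∃ e : ℝ, (e = 1 ∨ e = -1) ∧ 0 < e * (h x - h p) := by
    intro x hx hxO
    rcases hc.boundary x hx hxO with h1 | h1 <;> rw [h1]
    · exact ⟨-1, .inr rfl, by linarith [hc.lt_left]⟩
    · exact ⟨1, .inl rfl, by linarith [hc.lt_right]⟩
  obtain ⟨e, he, hend⟩ : ∃ e : ℝ, (e = 1 ∨ e = -1) ∧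
      ((A.c i u = p ∧ A.c i v ∉ O ∧ 0 < e * (h (A.c i v) - h p)) ∨
        (A.c i v = p ∧ A.c i u ∉ O ∧ 0 < e * (h (A.c i u) - h p))) := by
    rcases ha.ends with ⟨h1, h2⟩ | ⟨h1, h2⟩
    · obtain ⟨e, he, he'⟩ := hpos _ (ha.mapsTo_closure hv) h2
      exact ⟨e, he, .inl ⟨h1, h2, he'⟩⟩
    · obtain ⟨e, he, he'⟩ := hpos _ (ha.mapsTo_closure hu) h2
      exact ⟨e, he, .inr ⟨h1, h2, he'⟩⟩
  have hee : e * e = 1 := by rcases he with rfl | rfl <;> norm_num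
  have he0 : e ≠ 0 := by rcases he with rfl | rfl <;> norm_num
  set φ : ℝ → ℝ := fun t => e * ((h ∘ A.c i) t - h p) with hφdef
  have hφ : ContDiffOn ℝ ∞ φ (Icc u v) :=
    contDiffOn_const.mul ((H.contDiffOn ha.subset hD).sub contDiffOn_const)
  have hdφ : ∀ t ∈ Icc u v, derivWithin φ (Icc u v) t ≠ 0 := by
    intro t ht
    have h1 := ((H.contDiffOn ha.subset hD t ht).differentiableWithinAt
      (by simp)).hasDerivWithinAt
    rw [((h1.sub_const (h p)).const_mul e).derivWithin (uniqueDiffOn_Icc ha.lt t ht)]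
    exact mul_ne_zero he0 (H.derivWithin_Icc ha.lt ha.subset hD ht)
  have hinj : InjOn φ (Icc u v) := by
    intro x hx y hy hxy
    exact H.injOn ha.subset hD hx hy (by simpa [hφdef, he0] using hxy)
  have hmono := strictMonoOn_or_strictAntiOn_of_derivWithin_ne_zero
    (fun t ht => (hφ t ht).differentiableWithinAt (by simp)) hdφ
  -- Here w₀ is the end at p and w the far end. Arcs leaving p make φ increasing and give the
  -- positive alternative, arcs arriving at p the negative one.
  obtain ⟨w₀, w, L, hw₀, hw, hL, hw₀p, hwO, hφw₀, hφw, himg, hpar, hIoo⟩ : ∃ w₀ w L,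
      w₀ ∈ Icc u v ∧ w ∈ Icc u v ∧ 0 < L ∧ A.c i w₀ = p ∧ A.c i w ∉ O ∧ φ w₀ = 0 ∧ φ w = L ∧
      φ '' Icc u v = Icc 0 L ∧ (∀ g, (∀ t ∈ Icc u v, A.c i t = g (φ t)) →
        PosReparam (A.c i) u v g 0 L ∨ NegReparam (A.c i) u v g 0 L) ∧
      ∀ t, t ∈ Icc u v → (t ∈ Ioo u v ↔ t ≠ w₀ ∧ t ≠ w) := by
    rcases hend with ⟨h1, h2, h3⟩ | ⟨h1, h2, h3⟩
    · have hφu : φ u = 0 := by simp [hφdef, h1]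
      rcases hmono with ⟨hm, hd⟩ | ⟨hm, -⟩
      · refine ⟨u, v, φ v, hu, hv, h3, h1, h2, hφu, rfl, ?_,
          fun g hg => .inl ⟨φ, hφ, hd, hφu, rfl, hg⟩, fun t ht => ?_⟩
        · refine Subset.antisymm ?_ ?_
          · rintro _ ⟨t, ht, rfl⟩
            exact ⟨hφu ▸ hm.monotoneOn hu ht ht.1, hm.monotoneOn ht hv ht.2⟩
          · exact hφu ▸ intermediate_value_Icc ha.lt.le hφ.continuousOn
        · exact ⟨fun h' => ⟨h'.1.ne', h'.2.ne⟩, fun h' => ⟨lt_of_le_of_ne ht.1 h'.1.symm,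
            lt_of_le_of_ne ht.2 h'.2⟩⟩
      · have : φ v < φ u := hm hu hv ha.lt
        rw [hφu] at this
        exact absurd h3 this.not_gt
    · have hφv : φ v = 0 := by simp [hφdef, h1]
      rcases hmono with ⟨hm, -⟩ | ⟨hm, hd⟩
      · have : φ u < φ v := hm hu hv ha.lt
        rw [hφv] at this
        exact absurd h3 this.not_gt
      · refine ⟨v, u, φ u, hv, hu, h3, h1, h2, hφv, rfl, ?_,
          fun g hg => .inr ⟨φ, hφ, hd, rfl, hφv, hg⟩, fun t ht => ?_⟩
        · refine Subset.antisymm ?_ ?_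
          · rintro _ ⟨t, ht, rfl⟩
            exact ⟨hφv ▸ hm.antitoneOn ht hv ht.2, hm.antitoneOn hu ht ht.1⟩
          · exact hφv ▸ intermediate_value_Icc' ha.lt.le hφ.continuousOn
        · exact ⟨fun h' => ⟨h'.2.ne, h'.1.ne'⟩, fun h' => ⟨lt_of_le_of_ne ht.1 h'.2.symm,
            lt_of_le_of_ne ht.2 h'.1⟩⟩
  obtain ⟨ψ, hψ, hmaps, hleft, hright, hdψ⟩ := exists_contDiffOn_inverse hL hφ hdφ hinj himg
  have hS : SmoothImmersionOn N (A.c i ∘ ψ) (Icc 0 L) :=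
    ((A.imm i).mono ha.subset (uniqueDiffOn_Icc ha.lt)).comp_inverse hL hψ hmaps hdψ
  have hφmem : ∀ t ∈ Icc u v, φ t ∈ Icc 0 L := fun t ht => himg ▸ mem_image_of_mem φ ht
  have hψ0 : ψ 0 = w₀ := by rw [← hφw₀, hleft _ hw₀]
  have hψL : ψ L = w := by rw [← hφw, hleft _ hw]
  refine ⟨Curve.ofSmooth (A.c i ∘ ψ) 0 L hL hS, e, he, rfl, ?_, ?_, ?_, ?_, ?_, hS, ?_⟩
  · change A.c i (ψ 0) = p
    rw [hψ0, hw₀p]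
  · change A.c i (ψ L) ∉ O
    rwa [hψL]
  · change (A.c i ∘ ψ) '' Ioo 0 L = _
    rw [image_comp]
    congr 1
    ext t
    constructor
    · rintro ⟨r, hr, rfl⟩
      have hrI := Ioo_subset_Icc_self hr
      refine (hIoo _ (hmaps hrI)).2 ⟨fun h' => ?_, fun h' => ?_⟩
      · have := hright r hrI
        rw [h', hφw₀] at this
        exact hr.1.ne this
      · have := hright r hrI
        rw [h', hφw] at this
        exact hr.2.ne' this
    · intro ht
      have htI := Ioo_subset_Icc_self ht
      obtain ⟨hn₀, hn⟩ := (hIoo t htI).1 ht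
      refine ⟨φ t, ⟨lt_of_le_of_ne (hφmem t htI).1 ?_, lt_of_le_of_ne (hφmem t htI).2 ?_⟩,
        hleft t htI⟩
      · exact fun h' => hn₀ (hinj htI hw₀ (by rw [hφw₀, h']))
      · exact fun h' => hn (hinj htI hw (by rw [hφw, h']))
  · change (A.c i ∘ ψ) '' Icc 0 L = _
    rw [image_comp, hmaps.image_subset.antisymm fun t ht => ⟨φ t, hφmem t ht, hleft t ht⟩]
  · intro r hr
    change h (A.c i (ψ r)) = h p + e * r
    have h1 : e * (h (A.c i (ψ r)) - h p) = r := hright r hr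
    have h2 : e * r = h (A.c i (ψ r)) - h p := calc
      e * r = e * (e * (h (A.c i (ψ r)) - h p)) := by rw [h1]
      _ = h (A.c i (ψ r)) - h p := by rw [← mul_assoc, hee, one_mul]
    rw [h2]
    ring
  · intro g hg
    refine hpar g fun t ht => ?_
    rw [hg (hφmem t ht)]
    change A.c i t = A.c i (ψ (φ t))
    rw [hleft t ht]

theorem Curve.Same.range_eq {c c' : Curve N M} (hs : c.Same c') : c.range = c'.range := by
  unfold Curve.range Curve.dom
  rw [← hs.1, ← hs.2.1]
  exact hs.2.2.image_eq

/-- A finite set of curves contains a family to one of whose members each of its curves is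
equal on its domain. -/
theorem exists_curveFamily {F : Set (Curve N M)} (hF : F.Finite) :
    ∃ T : CurveFamily N M, (∀ i, T.curve i ∈ F) ∧ ∀ c ∈ F, ∃ i, (T.curve i).Same c := by
  let r : Setoid (Curve N M) :=
    { r := Curve.Same
      iseqv :=
        { refl := fun c => ⟨rfl, rfl, fun _ _ => rfl⟩
          symm := fun {c c'} hs => ⟨hs.1.symm, hs.2.1.symm, fun t ht =>
            (hs.2.2 (by unfold Curve.dom at *; rwa [hs.1, hs.2.1])).symm⟩
          trans := fun {c c' c''} hs hs' => ⟨hs.1.trans hs'.1, hs.2.1.trans hs'.2.1, fun t ht =>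
            (hs.2.2 ht).trans (hs'.2.2 (by unfold Curve.dom at *; rwa [← hs.1, ← hs.2.1]))⟩ } }
  have hfin : Finite (Quotient.mk r '' F) := (hF.image _).to_subtype
  obtain ⟨n, ⟨E⟩⟩ := Finite.exists_equiv_fin (Quotient.mk r '' F)
  choose f hfF hf using fun x : Quotient.mk r '' F => x.2
  refine ⟨⟨n, fun i => f (E.symm i), fun i j hij => ?_⟩, fun i => hfF _, fun c hc => ?_⟩
  · refine E.symm.injective (Subtype.ext ?_)
    rw [← hf, ← hf]
    exact Quotient.sound (s := r) hij
  · refine ⟨E ⟨Quotient.mk r c, mem_image_of_mem _ hc⟩, ?_⟩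
    refine Quotient.exact (s := r) ?_
    change Quotient.mk r (f (E.symm (E ⟨Quotient.mk r c, mem_image_of_mem _ hc⟩))) = _
    rw [E.symm_apply_apply]
    exact hf _

theorem PosReparam.refl {X : Type*} (f : ℝ → X) {a b : ℝ} (hab : a < b) : PosReparam f a b f a b :=
  ⟨id, contDiffOn_id, fun t ht => by
    rw [derivWithin_id _ _ (uniqueDiffOn_Icc hab t ht)]; exact one_pos, rfl, rfl, fun _ _ => rfl⟩

/-- An arc reaching a point covers all heights close to that of the point on one side. -/
theorem IsHeight.exists_one_sided (H : IsHeight A D h) {i : A.ι} {u v : ℝ} (huv : u < v)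
    (hS : Icc u v ⊆ A.dom i) {q : M} (hq : A.c i u = q ∨ A.c i v = q) {U : Set M} (hU : U ∈ 𝓝 q)
    (hUD : U ⊆ D) : ∃ δ > 0, Ioo (h q) (h q + δ) ⊆ h '' (U ∩ A.c i '' Ioo u v) ∨
      Ioo (h q - δ) (h q) ⊆ h '' (U ∩ A.c i '' Ioo u v) := by
  obtain ⟨u', v', huv', hsub, hmaps, hq'⟩ : ∃ u' v', u' < v' ∧ Icc u' v' ⊆ Icc u v ∧
      MapsTo (A.c i) (Icc u' v') U ∧ (A.c i u' = q ∨ A.c i v' = q) := by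
    rcases hq with rfl | rfl
    · have hu := left_mem_Icc.2 huv.le
      have h1 : A.c i ⁻¹' U ∈ 𝓝[Icc u v] u := (A.continuousOn i u (hS hu)).mono hS hU
      rw [nhdsWithin_Icc_eq_nhdsGE huv] at h1
      obtain ⟨v', hv', hsub⟩ := mem_nhdsGE_iff_exists_Icc_subset.1 h1
      have hlt : u < min v' v := lt_min hv' huv
      exact ⟨u, min v' v, hlt, Icc_subset_Icc_right (min_le_right _ _),
        fun t ht => hsub ⟨ht.1, ht.2.trans (min_le_left _ _)⟩, .inl rfl⟩
    · have hv := right_mem_Icc.2 huv.le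
      have h1 : A.c i ⁻¹' U ∈ 𝓝[Icc u v] v := (A.continuousOn i v (hS hv)).mono hS hU
      rw [nhdsWithin_Icc_eq_nhdsLE huv] at h1
      obtain ⟨u', hu', hsub⟩ := mem_nhdsLE_iff_exists_Icc_subset.1 h1
      have hlt : max u' u < v := max_lt hu' huv
      exact ⟨max u' u, v, hlt, Icc_subset_Icc_left (le_max_right _ _),
        fun t ht => hsub ⟨(le_max_left _ _).trans ht.1, ht.2⟩, .inr rfl⟩
  have hS' := hsub.trans hS
  have hD : MapsTo (A.c i) (Icc u' v') D := fun t ht => hUD (hmaps ht)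
  have hIoo : Ioo u' v' ⊆ Ioo u v := Ioo_subset_Ioo (hsub (left_mem_Icc.2 huv'.le)).1
    (hsub (right_mem_Icc.2 huv'.le)).2
  have himg : uIoo (h (A.c i u')) (h (A.c i v')) ⊆ h '' (U ∩ A.c i '' Ioo u v) := by
    rw [← H.image_Ioo huv'.le hS' hD]
    refine image_mono ?_
    rintro _ ⟨t, ht, rfl⟩
    exact ⟨hmaps (Ioo_subset_Icc_self ht), mem_image_of_mem _ (hIoo ht)⟩
  obtain ⟨z, hz, hzimg⟩ : ∃ z, z ≠ h q ∧ uIoo (h q) z ⊆ h '' (U ∩ A.c i '' Ioo u v) := by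
    have hne : h (A.c i u') ≠ h (A.c i v') := fun he =>
      huv'.ne (H.injOn hS' hD (left_mem_Icc.2 huv'.le) (right_mem_Icc.2 huv'.le) he)
    rcases hq' with rfl | rfl
    · exact ⟨_, hne.symm, himg⟩
    · exact ⟨_, hne, uIoo_comm (h (A.c i u')) _ ▸ himg⟩
  rcases lt_or_gt_of_ne hz with hlt | hgt
  · refine ⟨h q - z, by linarith, .inr ?_⟩
    rw [uIoo_of_ge hlt.le] at hzimg
    simpa using hzimg
  · refine ⟨z - h q, by linarith, .inl ?_⟩
    rw [uIoo_of_le hgt.le] at hzimg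
    simpa using hzimg

/-- Two disjoint arcs that reach a nice point together fill a neighbourhood of the point. -/
theorem ArcSystem.IsNice.eventually_mem_of_disjoint {q : M} (hq : A.IsNice q) (H : IsHeight A D h)
    (hqD : q ∈ D) (hqA : q ∈ A.carrier) {i j : A.ι} {u v u' v' : ℝ} (huv : u < v)
    (hS : Icc u v ⊆ A.dom i) (hqi : A.c i u = q ∨ A.c i v = q) (huv' : u' < v')
    (hS' : Icc u' v' ⊆ A.dom j) (hqj : A.c j u' = q ∨ A.c j v' = q)
    (hdisj : Disjoint (A.c i '' Ioo u v) (A.c j '' Ioo u' v')) :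
    ∀ᶠ x in 𝓝 q, x ∈ A.carrier → x ∈ A.c i '' Icc u v ∪ A.c j '' Icc u' v' := by
  obtain ⟨Q, hQ, hqQ, hQD, -, hinj⟩ := hq D h H hqD
  have hcar : ∀ {k : A.ι} {w w' : ℝ}, Icc w w' ⊆ A.dom k → ∀ y ∈ A.c k '' Ioo w w',
      y ∈ A.carrier := by
    rintro k w w' hk _ ⟨t, ht, rfl⟩
    exact A.apply_mem (hk (Ioo_subset_Icc_self ht))
  have hmeet : ∀ r, r ∈ h '' (Q ∩ A.c i '' Ioo u v) → r ∈ h '' (Q ∩ A.c j '' Ioo u' v') →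
      False := by
    rintro _ ⟨y, ⟨hyQ, hy⟩, rfl⟩ ⟨y', ⟨hyQ', hy'⟩, hyy⟩
    rw [hinj ⟨hyQ', hcar hS' y' hy'⟩ ⟨hyQ, hcar hS y hy⟩ hyy] at hy'
    exact disjoint_left.1 hdisj hy hy'
  have hfill : ∀ x ∈ Q ∩ A.carrier, h x ∈ h '' (Q ∩ A.c i '' Ioo u v) ∨
      h x ∈ h '' (Q ∩ A.c j '' Ioo u' v') → x ∈ A.c i '' Icc u v ∪ A.c j '' Icc u' v' := by
    rintro x hx (⟨y, ⟨hyQ, hy⟩, hyx⟩ | ⟨y, ⟨hyQ, hy⟩, hyx⟩)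
    · exact .inl (hinj ⟨hyQ, hcar hS y hy⟩ hx hyx ▸ image_mono Ioo_subset_Icc_self hy)
    · exact .inr (hinj ⟨hyQ, hcar hS' y hy⟩ hx hyx ▸ image_mono Ioo_subset_Icc_self hy)
  have hqmem : q ∈ A.c i '' Icc u v ∪ A.c j '' Icc u' v' := by
    rcases hqi with rfl | rfl
    · exact .inl (mem_image_of_mem _ (left_mem_Icc.2 huv.le))
    · exact .inl (mem_image_of_mem _ (right_mem_Icc.2 huv.le))
  obtain ⟨δ, hδ, h1⟩ := H.exists_one_sided huv hS hqi (hQ.mem_nhds hqQ) hQD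
  obtain ⟨δ', hδ', h2⟩ := H.exists_one_sided huv' hS' hqj (hQ.mem_nhds hqQ) hQD
  have hm : 0 < min δ δ' := lt_min hδ hδ'
  have hml := min_le_left δ δ'
  have hmr := min_le_right δ δ'
  have hnear : ∀ᶠ x in 𝓝 q, h x ∈ Ioo (h q - min δ δ') (h q + min δ δ') :=
    (H.continuousOn.continuousAt (H.isOpen.mem_nhds hqD)).eventually_mem
      (Ioo_mem_nhds (by linarith) (by linarith))
  filter_upwards [hnear, hQ.mem_nhds hqQ] with x hx hxQ hxA
  -- If both arcs covered the same side of h q, injectivity of the height would force them to share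
  -- points. So they cover opposite sides, hence all of the carrier near q.
  rcases h1 with h1 | h1 <;> rcases h2 with h2 | h2
  · exact (hmeet (h q + min δ δ' / 2) (h1 ⟨by linarith, by linarith⟩)
      (h2 ⟨by linarith, by linarith⟩)).elim
  · rcases lt_trichotomy (h x) (h q) with hlt | heq | hgt
    · exact hfill x ⟨hxQ, hxA⟩ (.inr (h2 ⟨by linarith [hx.1], hlt⟩))
    · exact hinj ⟨hxQ, hxA⟩ ⟨hqQ, hqA⟩ heq ▸ hqmem
    · exact hfill x ⟨hxQ, hxA⟩ (.inl (h1 ⟨hgt, by linarith [hx.2]⟩))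
  · rcases lt_trichotomy (h x) (h q) with hlt | heq | hgt
    · exact hfill x ⟨hxQ, hxA⟩ (.inl (h1 ⟨by linarith [hx.1], hlt⟩))
    · exact hinj ⟨hxQ, hxA⟩ ⟨hqQ, hqA⟩ heq ▸ hqmem
    · exact hfill x ⟨hxQ, hxA⟩ (.inr (h2 ⟨hgt, by linarith [hx.2]⟩))
  · exact (hmeet (h q - min δ δ' / 2) (h1 ⟨by linarith, by linarith⟩)
      (h2 ⟨by linarith, by linarith⟩)).elim

end Assembly

/-! ### The tassel of a cell -/

section Tassels

open Filter

variable {N : ℕ} {M : Type*} [TopologicalSpace M] [ChartedSpace (EuclideanSpace ℝ (Fin N)) M]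
  {A : ArcSystem N M} {O : Set M} {p : M} {D : Set M} {h : M → ℝ} {s s' : ℝ}

namespace IsHeightParam

variable {i j : A.ι} {u v u' v' : ℝ} {S S' : Curve N M} {e e' : ℝ}

theorem pos (hS : IsHeightParam A O p h i u v S e) : 0 < S.b := hS.left ▸ S.a_lt_b

theorem dom_eq (hS : IsHeightParam A O p h i u v S e) : S.dom = Icc 0 S.b := by
  rw [Curve.dom, hS.left]

theorem range_eq (hS : IsHeightParam A O p h i u v S e) : S.range = A.c i '' Icc u v := by
  rw [Curve.range, hS.dom_eq, hS.image_Icc]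

theorem mem_image_Ioo (hS : IsHeightParam A O p h i u v S e) {x : M} (hx : x ∈ S.range)
    (hxp : x ≠ p) (hxO : x ∈ O) : x ∈ A.c i '' Ioo u v := by
  rw [Curve.range, hS.dom_eq] at hx
  obtain ⟨r, hr, rfl⟩ := hx
  rw [← hS.image_Ioo]
  refine mem_image_of_mem _ ⟨lt_of_le_of_ne hr.1 ?_, lt_of_le_of_ne hr.2 ?_⟩
  · rintro rfl
    exact hxp hS.apply_zero
  · intro hrb
    exact hS.apply_right (hrb ▸ hxO)

theorem param_eq (hS : IsHeightParam A O p h i u v S e) (hS' : IsHeightParam A O p h j u' v' S' e')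
    {r r' : ℝ} (hr : r ∈ Icc 0 S.b) (hr' : r' ∈ Icc 0 S'.b) (heq : S.toFun r = S'.toFun r') :
    r = r' := by
  have h1 := hS.height r hr
  rw [heq, hS'.height r' hr'] at h1
  have h0 := hr.1
  have h0' := hr'.1
  rcases hS.sign with rfl | rfl <;> rcases hS'.sign with rfl | rfl <;> linarith

/-- A common point on the boundary of the cell is nice. Both curves reach it at the same parameter
and on the same side of p, so just before it they have equal heights and must coincide. -/
theorem nonempty_inter (hS : IsHeightParam A O p h i u v S e)
    (hS' : IsHeightParam A O p h j u' v' S' e') (ha : IsHalfArc A O p i u v)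
    (ha' : IsHalfArc A O p j u' v') (hH : IsHeight A D h) (hD : closure O ∩ A.carrier ⊆ D)
    (hnice : ∀ x ∈ closure O ∩ A.carrier, x ∉ O → A.IsNice x) {q : M} (hqp : q ≠ p)
    (hq : q ∈ S.range) (hq' : q ∈ S'.range) :
    (A.c i '' Ioo u v ∩ A.c j '' Ioo u' v').Nonempty := by
  by_cases hqO : q ∈ O
  · exact ⟨q, hS.mem_image_Ioo hq hqp hqO, hS'.mem_image_Ioo hq' hqp hqO⟩
  have hqcl : q ∈ closure O ∩ A.carrier := by
    obtain ⟨t, ht, rfl⟩ := hS.range_eq ▸ hq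
    exact ha.mapsTo_closure ht
  obtain ⟨Q, hQ, hqQ, -, -, hinj⟩ := hnice q hqcl hqO D h hH (hD hqcl)
  rw [Curve.range, hS.dom_eq] at hq
  rw [Curve.range, hS'.dom_eq] at hq'
  obtain ⟨r, hr, rfl⟩ := hq
  obtain ⟨r', hr', hrr⟩ := hq'
  obtain rfl := hS.param_eq hS' hr hr' hrr.symm
  have hr0 : 0 < r := lt_of_le_of_ne hr.1 (by rintro rfl; exact hqp hS.apply_zero)
  have hee : e = e' := by
    have h1 := hS.height r hr
    rw [← hrr, hS'.height r hr'] at h1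
    exact mul_right_cancel₀ hr0.ne' (by linarith)
  subst hee
  have hnear : ∀ {T : Curve N M}, ContinuousOn T.toFun (Icc 0 T.b) → r ∈ Icc 0 T.b →
      T.toFun r ∈ Q → ∀ᶠ w in 𝓝[<] r, T.toFun w ∈ Q := by
    intro T hT hrT hmem
    have h1 := (hT r hrT).eventually_mem (hQ.mem_nhds hmem)
    have h2 : Ioo 0 r ⊆ Icc 0 T.b := fun w hw => ⟨hw.1.le, hw.2.le.trans hrT.2⟩
    rw [← nhdsWithin_Ioo_eq_nhdsLT hr0]
    exact h1.filter_mono (nhdsWithin_mono _ h2)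
  obtain ⟨w, ⟨⟨hw, hw'⟩, hw0, hwr⟩⟩ := (((hnear hS.smooth.1.continuousOn hr hqQ).and
    (hnear hS'.smooth.1.continuousOn hr' (hrr ▸ hqQ))).and (Ioo_mem_nhdsLT hr0)).exists
  have h1 : w ∈ Ioo 0 S.b := ⟨hw0, hwr.trans_le hr.2⟩
  have h2 : w ∈ Ioo 0 S'.b := ⟨hw0, hwr.trans_le hr'.2⟩
  have hmem : S.toFun w ∈ A.c i '' Ioo u v := hS.image_Ioo ▸ mem_image_of_mem _ h1
  have hmem' : S'.toFun w ∈ A.c j '' Ioo u' v' := hS'.image_Ioo ▸ mem_image_of_mem _ h2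
  have heq : S.toFun w = S'.toFun w := hinj ⟨hw, (ha.image_subset hmem).2⟩
    ⟨hw', (ha'.image_subset hmem').2⟩
    ((hS.height w (Ioo_subset_Icc_self h1)).trans (hS'.height w (Ioo_subset_Icc_self h2)).symm)
  exact ⟨S.toFun w, hmem, heq ▸ hmem'⟩

end IsHeightParam

/-- Inside O the tassel and the carrier are the same set, so regularity and incidence transfer
between them. Niceness on the boundary handles curves meeting only at their far ends. -/
theorem IsCell.exists_tassel (G : Type*) [Group G] (hc : IsCell A O p)
    (hfin : {x : A.ι × ℝ × ℝ | IsHalfArc A O p x.1 x.2.1 x.2.2}.Finite)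
    (hne : ∃ i u v, IsHalfArc A O p i u v)
    (hcov : ∀ x ∈ O ∩ A.carrier, x ≠ p → ∃ i u v, IsHalfArc A O p i u v ∧ x ∈ A.c i '' Ioo u v)
    (hnice : ∀ x ∈ closure O ∩ A.carrier, x ∉ O → A.IsNice x) :
    ∃ T : CurveFamily N M, T.IsTassel G p ∧
      (∀ k, ∃ i u v, IsHalfArc A O p i u v ∧ (T.curve k).range = A.c i '' Icc u v ∧
        ∀ t ∈ (T.curve k).dom, (T.curve k).toFun t ∉ O → t = (T.curve k).b) ∧
      ∀ i u v, IsHalfArc A O p i u v → ∃ k,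
        PosReparam (A.c i) u v (T.curve k).toFun (T.curve k).a (T.curve k).b ∨
        NegReparam (A.c i) u v (T.curve k).toFun (T.curve k).a (T.curve k).b := by
  obtain ⟨D, h, s, s', hpre⟩ := hc.pre
  have : Finite {x : A.ι × ℝ × ℝ | IsHalfArc A O p x.1 x.2.1 x.2.2} := hfin.to_subtype
  choose S e hS using fun x : {x : A.ι × ℝ × ℝ | IsHalfArc A O p x.1 x.2.1 x.2.2} =>
    hpre.exists_isHeightParam x.2
  -- Different half arcs may yield the same parametrized curve, which a family can list only once.
  obtain ⟨T, hTF, hFT⟩ := exists_curveFamily (finite_range S)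
  choose a haT using hTF
  have hP : ∀ k, IsHeightParam A O p h (a k).1.1 (a k).1.2.1 (a k).1.2.2 (T.curve k) (e (a k)) :=
    fun k => haT k ▸ hS (a k)
  have hA : ∀ k, IsHalfArc A O p (a k).1.1 (a k).1.2.1 (a k).1.2.2 := fun k => (a k).2
  have hsurj : ∀ i u v, IsHalfArc A O p i u v → ∃ k, (T.curve k).range = A.c i '' Icc u v ∧
      (PosReparam (A.c i) u v (T.curve k).toFun (T.curve k).a (T.curve k).b ∨
        NegReparam (A.c i) u v (T.curve k).toFun (T.curve k).a (T.curve k).b) := by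
    intro i u v ha
    obtain ⟨k, hk⟩ := hFT _ (mem_range_self ⟨(i, u, v), ha⟩)
    have hk' := hS ⟨(i, u, v), ha⟩
    refine ⟨k, hk.range_eq.trans hk'.range_eq, ?_⟩
    have := hk'.reparam (T.curve k).toFun (by
      have := hk.2.2
      rwa [Curve.dom, hk.1, hk.2.1] at this)
    rwa [← hk.1, ← hk.2.1] at this
  have hpT : p ∈ T.range := by
    obtain ⟨i, u, v, ha⟩ := hne
    obtain ⟨k, -⟩ := hsurj i u v ha
    refine mem_iUnion.2 ⟨k, 0, ?_, (hP k).apply_zero⟩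
    rw [(hP k).dom_eq]
    exact left_mem_Icc.2 (hP k).pos.le
  have hTcl : T.range ⊆ closure O ∩ A.carrier := by
    refine iUnion_subset fun k => ?_
    rw [(hP k).range_eq]
    exact (hA k).mapsTo_closure.image_subset
  have hOT : O ∩ A.carrier = O ∩ T.range := by
    refine Subset.antisymm (fun x hx => ⟨hx.1, ?_⟩) fun x hx => ⟨hx.1, (hTcl hx.2).2⟩
    by_cases hxp : x = p
    · rwa [hxp]
    · obtain ⟨i, u, v, ha, hxa⟩ := hcov x hx hxp
      obtain ⟨k, hk, -⟩ := hsurj i u v ha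
      exact mem_iUnion.2 ⟨k, hk ▸ image_mono Ioo_subset_Icc_self hxa⟩
  have hmemIoo : ∀ k x, x ∈ O → x ≠ p → (x ∈ (T.curve k).range ↔
      x ∈ A.c (a k).1.1 '' Ioo (a k).1.2.1 (a k).1.2.2) := fun k x hxO hxp =>
    ⟨fun hx => (hP k).mem_image_Ioo hx hxp hxO, fun hx => (hP k).range_eq ▸
      image_mono Ioo_subset_Icc_self hx⟩
  refine ⟨T, ⟨hpT, ⟨D, hpre.isHeight.isOpen, hpre.isHeight.contractible,
    hTcl.trans hpre.closure_subset⟩, ⟨T.curve, fun k => PosReparam.refl _ (T.curve k).a_lt_b,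
    fun k l r hr r' hr' heq => ?_, fun k => ⟨(hP k).left, (hP k).apply_zero⟩⟩, ?_, ?_⟩,
    fun k => ⟨_, _, _, hA k, (hP k).range_eq, fun t ht htO => ?_⟩,
    fun i u v ha => (hsurj i u v ha).imp fun _ => And.right⟩
  · rw [(hP k).dom_eq] at hr
    rw [(hP l).dom_eq] at hr'
    exact (hP k).param_eq (hP l) hr hr' heq
  · rintro k l - ⟨q, hqp, hqk, hql⟩ U hU
    have := hc.meet _ _ _ _ _ _ (hA k) (hA l) ((hP k).nonempty_inter (hP l) (hA k) (hA l)
      hpre.isHeight hpre.closure_subset hnice hqp hqk hql)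
    obtain ⟨x, ⟨hx, hx'⟩, hxU⟩ := (this.and_eventually hU).exists
    refine ⟨x, hxU, ?_, (hP k).range_eq ▸ image_mono Ioo_subset_Icc_self hx,
      (hP l).range_eq ▸ image_mono Ioo_subset_Icc_self hx'⟩
    obtain ⟨t, ht, rfl⟩ := hx
    exact ((hA k).mapsTo ht).2
  · rintro q ⟨hqT, hqreg, hqL⟩ U hU
    obtain ⟨k, t, ht, htq⟩ := mem_iUnion.1 hqT
    obtain ⟨hta, htb, -⟩ := hqreg k t ht htq
    have htI : t ∈ Ioo 0 (T.curve k).b := by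
      rw [(hP k).dom_eq] at ht
      rw [(hP k).left] at hta
      exact ⟨lt_of_le_of_ne ht.1 hta.symm, lt_of_le_of_ne ht.2 htb⟩
    have hqI : q ∈ A.c (a k).1.1 '' Ioo (a k).1.2.1 (a k).1.2.2 := by
      rw [← (hP k).image_Ioo]
      exact ⟨t, htI, htq⟩
    have hqO := (hA k).image_subset hqI
    have hqp : q ≠ p := by
      obtain ⟨w, hw, rfl⟩ := hqI
      exact ((hA k).mapsTo hw).2
    have hqLA : IsLocArc N A.carrier q :=
      IsLocArc.congr hqL hqT (hpre.isOpen.mem_nhds hqO.1) hOT.symm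
    obtain ⟨y, ⟨hyO, hyp, hyL, hy⟩, hyU⟩ :=
      ((hc.types q hqO hqp hqLA).and_eventually hU).exists
    have hyT : y ∈ T.range := (hOT ▸ hyO : y ∈ O ∩ T.range).2
    refine ⟨y, hyU, ⟨hyT, fun l r hr hry => ?_,
      hyL.congr hyO.2 (hpre.isOpen.mem_nhds hyO.1) hOT⟩, ?_⟩
    · rw [(hP l).dom_eq] at hr
      have hr0 : r ≠ 0 := by
        rintro rfl
        exact hyp (hry ▸ (hP l).apply_zero)
      have hrb : r ≠ (T.curve l).b := by
        rintro rfl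
        exact (hP l).apply_right (hry ▸ hyO.1)
      refine ⟨(hP l).left ▸ hr0, hrb, ?_⟩
      exact (((hP l).smooth.1 r hr).contMDiffAt (Icc_mem_nhds (lt_of_le_of_ne hr.1 hr0.symm)
        (lt_of_le_of_ne hr.2 hrb))).mdifferentiableAt (by simp)
    · have hiff : ∀ l, y ∈ (T.curve l).range ↔ q ∈ (T.curve l).range := fun l => by
        rw [hmemIoo l y hyO.1 hyp, hmemIoo l q hqO.1 hqp, hy _ _ _ (hA l)]
      ext x
      change (∃ g : G, ∀ l, (y ∈ (T.curve l).range → x l = g) ∧ (y ∉ (T.curve l).range → x l = 1)) ↔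
        ∃ g : G, ∀ l, (q ∈ (T.curve l).range → x l = g) ∧ (q ∉ (T.curve l).range → x l = 1)
      simp only [hiff]
  · rw [(hP k).dom_eq] at ht
    by_contra hne
    refine htO ?_
    rcases ht.1.eq_or_lt with rfl | h0
    · rw [(hP k).apply_zero]
      exact hpre.mem
    · have h1 : (T.curve k).toFun t ∈ A.c (a k).1.1 '' Ioo (a k).1.2.1 (a k).1.2.2 :=
        (hP k).image_Ioo ▸ mem_image_of_mem _ ⟨h0, lt_of_le_of_ne ht.2 hne⟩
      exact ((hA k).image_subset h1).1

end Tassels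

/-! ### The web of an arc system and of a family -/

section Webs

open Filter

variable {N : ℕ} {M : Type*} [TopologicalSpace M] [ChartedSpace (EuclideanSpace ℝ (Fin N)) M]

theorem ArcSystem.exists_web [T2Space M] [IsManifold (𝓡 N) ∞ M] (G : Type*) [Group G]
    (A : ArcSystem N M) :
    ∃ W : Web G N M, ∀ i, IsProductOf W.curves (A.c i) (A.a i) (A.b i) := by
  have := A.finite
  obtain ⟨𝒪, hfin, hcell, hpd, hcut⟩ := A.isWebbable_univ
  rw [univ_inter] at hcut
  set Q := A.carrier \ ⋃ o ∈ 𝒪, o.1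
  replace hcell := fun o ho => (hcell o ho).1
  have hopen : ∀ o ∈ 𝒪, IsOpen o.1 := fun o ho => by
    obtain ⟨_, _, _, _, hpre⟩ := (hcell o ho).pre
    exact hpre.isOpen
  have hbase : ∀ o ∈ 𝒪, o.2 ∈ o.1 ∧ o.2 ∈ A.carrier := fun o ho => by
    obtain ⟨_, _, _, _, hpre⟩ := (hcell o ho).pre
    exact ⟨hpre.mem, hpre.mem_carrier⟩
  have huniq : ∀ o ∈ 𝒪, ∀ o' ∈ 𝒪, ∀ x ∈ o.1, x ∈ closure o'.1 → o = o' := by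
    intro o ho o' ho' x hx hx'
    by_contra hne
    exact disjoint_left.1 ((hpd ho ho' hne).closure_right (hopen o ho)) hx hx'
  have hQO : ∀ x ∈ Q, ∀ o ∈ 𝒪, x ∉ o.1 := fun x hx o ho hxo => hx.2 (mem_iUnion₂.2 ⟨o, ho, hxo⟩)
  have hbdry : ∀ o ∈ 𝒪, ∀ x ∈ closure o.1 ∩ A.carrier, x ∉ o.1 → x ∈ Q := by
    refine fun o ho x hx hxo => ⟨hx.2, fun hx' => ?_⟩
    obtain ⟨o', ho', hxo'⟩ := mem_iUnion₂.1 hx'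
    exact hxo (huniq o' ho' o ho x hxo' hx.1 ▸ hxo')
  -- The subdivision parameters of an arc: where it meets a leftover point or a base.
  let E : A.ι → Set ℝ := fun i => {t | t ∈ A.dom i ∧ (A.c i t ∈ Q ∨ ∃ o ∈ 𝒪, A.c i t = o.2)}
  have hE : ∀ i, (E i).Finite := by
    intro i
    refine ((hcut.1.union (hfin.image Prod.snd)).biUnion fun q _ => A.finite_fiber i q).subset ?_
    rintro t ⟨ht, hq | ⟨o, ho, hto⟩⟩
    · exact mem_iUnion₂.2 ⟨_, .inl hq, ht, rfl⟩
    · exact mem_iUnion₂.2 ⟨_, .inr ⟨o, ho, rfl⟩, ht, hto⟩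
  have hEO : ∀ i, ∀ t ∈ E i, ∀ o ∈ 𝒪, A.c i t ∈ o.1 → A.c i t = o.2 := by
    rintro i t ⟨-, hq | ⟨o', ho', hto⟩⟩ o ho hmem
    · exact absurd hmem (hQO _ hq o ho)
    · rw [huniq o ho o' ho' _ hmem (subset_closure (hto ▸ (hbase o' ho').1)), hto]
  have hOE : ∀ i, ∀ t ∈ A.dom i, t ∉ E i → ∃ o ∈ 𝒪, A.c i t ∈ o.1 ∧ A.c i t ≠ o.2 := by
    intro i t ht htE
    by_cases hq : A.c i t ∈ Q
    · exact absurd ⟨ht, .inl hq⟩ htE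
    · have hmem : A.c i t ∈ ⋃ o ∈ 𝒪, o.1 := by
        by_contra hn
        exact hq ⟨A.apply_mem ht, hn⟩
      obtain ⟨o, ho, hto⟩ := mem_iUnion₂.1 hmem
      exact ⟨o, ho, hto, fun heq => htE ⟨ht, .inr ⟨o, ho, heq⟩⟩⟩
  have hend : ∀ i, A.a i ∈ E i ∧ A.b i ∈ E i := by
    intro i
    have hal := left_mem_Icc.2 (A.lt i).le
    have hbr := right_mem_Icc.2 (A.lt i).le
    constructor <;> by_contra hn
    · obtain ⟨o, ho, hto, hne⟩ := hOE i _ hal hn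
      obtain ⟨_, _, _, _, hpre⟩ := (hcell o ho).pre
      exact hne ((hpre.endpoint i).1 hto)
    · obtain ⟨o, ho, hto, hne⟩ := hOE i _ hbr hn
      obtain ⟨_, _, _, _, hpre⟩ := (hcell o ho).pre
      exact hne ((hpre.endpoint i).2 hto)
  -- Between consecutive subdivision parameters the arc is connected and covered by disjoint open
  -- cells, so it stays in one. Monotonicity of the height forbids both ends being the base; two
  -- ends outside the cell would lie on opposite bounding levels and force a passage through the
  -- base in between.
  have hcons : ∀ i, ∀ u ∈ E i, ∀ v ∈ E i, u < v → (∀ z ∈ Ioo u v, z ∉ E i) →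
      ∃ o ∈ 𝒪, IsHalfArc A o.1 o.2 i u v := by
    intro i u hu v hv huv hno
    have hS : Icc u v ⊆ A.dom i := Icc_subset_Icc hu.1.1 hv.1.2
    have hpre : IsPreconnected (A.c i '' Ioo u v) :=
      isPreconnected_Ioo.image _ ((A.continuousOn i).mono (Ioo_subset_Icc_self.trans hS))
    obtain ⟨t, ht⟩ := nonempty_Ioo.2 huv
    obtain ⟨o, ho, hto, -⟩ := hOE i t (hS (Ioo_subset_Icc_self ht)) (hno t ht)
    have hsub : A.c i '' Ioo u v ⊆ o.1 := by
      refine hpre.subset_left_of_subset_union (hopen o ho)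
        (isOpen_biUnion fun o' (ho' : o' ∈ 𝒪 \ {o}) => hopen o' ho'.1) ?_ ?_
        ⟨_, mem_image_of_mem _ ht, hto⟩
      · exact disjoint_iUnion₂_right.2 fun o' ho' => hpd ho ho'.1 (Ne.symm ho'.2)
      · rintro _ ⟨w, hw, rfl⟩
        obtain ⟨o', ho', hwo, -⟩ := hOE i w (hS (Ioo_subset_Icc_self hw)) (hno w hw)
        by_cases hoo : o' = o
        · exact .inl (hoo ▸ hwo)
        · exact .inr (mem_iUnion₂.2 ⟨o', ⟨ho', hoo⟩, hwo⟩)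
    have hmaps : MapsTo (A.c i) (Ioo u v) (o.1 \ {o.2}) := fun w hw =>
      ⟨hsub (mem_image_of_mem _ hw), fun heq =>
        hno w hw ⟨hS (Ioo_subset_Icc_self hw), .inr ⟨o, ho, heq⟩⟩⟩
    have hcl : MapsTo (A.c i) (Icc u v) (closure o.1 ∩ A.carrier) := by
      intro w hw
      refine ⟨?_, A.apply_mem (hS hw)⟩
      have h1 : w ∈ closure (Ioo u v) := by rwa [closure_Ioo huv.ne]
      exact ((A.continuousOn i w (hS hw)).mono (Ioo_subset_Icc_self.trans hS)).mem_closure h1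
        fun x hx => (hmaps hx).1
    obtain ⟨D, h, s, s', hpc⟩ := (hcell o ho).pre
    have hD : MapsTo (A.c i) (Icc u v) D := fun w hw => hpc.closure_subset (hcl hw)
    have hul := left_mem_Icc.2 huv.le
    have hvr := right_mem_Icc.2 huv.le
    have hne : h (A.c i u) ≠ h (A.c i v) := fun heq =>
      huv.ne (hpc.isHeight.injOn hS hD hul hvr heq)
    refine ⟨o, ho, huv, hS, hmaps, ?_⟩
    by_cases hu' : A.c i u ∈ o.1 <;> by_cases hv' : A.c i v ∈ o.1
    · exact absurd (by rw [hEO i u hu o ho hu', hEO i v hv o ho hv']) hne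
    · exact .inl ⟨hEO i u hu o ho hu', hv'⟩
    · exact .inr ⟨hEO i v hv o ho hv', hu'⟩
    · exfalso
      have himg := hpc.isHeight.image_Ioo huv.le hS hD
      have hmem : h o.2 ∈ uIoo (h (A.c i u)) (h (A.c i v)) := by
        rcases hpc.boundary _ (hcl hul) hu' with h1 | h1 <;>
          rcases hpc.boundary _ (hcl hvr) hv' with h2 | h2 <;> rw [h1, h2] at hne ⊢
        · exact absurd rfl hne
        · exact mem_uIoo_of_lt hpc.lt_left hpc.lt_right
        · exact mem_uIoo_of_gt hpc.lt_left hpc.lt_right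
        · exact absurd rfl hne
      rw [← himg] at hmem
      obtain ⟨_, ⟨w, hw, rfl⟩, hwp⟩ := hmem
      exact (hmaps hw).2 (hpc.level _ (hcl (Ioo_subset_Icc_self hw)) hwp)
  have hhalf : ∀ i, ∀ t ∈ A.dom i, ∃ u v, t ∈ Icc u v ∧ (t ∉ E i → t ∈ Ioo u v) ∧
      ∃ o ∈ 𝒪, IsHalfArc A o.1 o.2 i u v := by
    intro i t ht
    by_cases htE : t ∈ E i
    · rcases ht.2.eq_or_lt with rfl | htb
      · obtain ⟨u, hu, hut, hno⟩ := exists_prev_of_finite (hE i) (hend i).1 (A.lt i)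
        exact ⟨u, _, ⟨hut.le, le_rfl⟩, fun hn => absurd htE hn, hcons i u hu _ htE hut hno⟩
      · obtain ⟨v, hv, htv, hno⟩ := exists_next_of_finite (hE i) (hend i).2 htb
        exact ⟨t, v, ⟨le_rfl, htv.le⟩, fun hn => absurd htE hn, hcons i t htE v hv htv hno⟩
    · have hat : A.a i < t := lt_of_le_of_ne ht.1 fun heq => htE (heq ▸ (hend i).1)
      have htb : t < A.b i := lt_of_le_of_ne ht.2 fun heq => htE (heq ▸ (hend i).2)
      obtain ⟨u, hu, hut, hno⟩ := exists_prev_of_finite (hE i) (hend i).1 hat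
      obtain ⟨v, hv, htv, hno'⟩ := exists_next_of_finite (hE i) (hend i).2 htb
      refine ⟨u, v, ⟨hut.le, htv.le⟩, fun _ => ⟨hut, htv⟩,
        hcons i u hu v hv (hut.trans htv) fun z hz => ?_⟩
      rcases lt_trichotomy z t with hlt | rfl | hgt
      · exact hno z ⟨hz.1, hlt⟩
      · exact htE
      · exact hno' z ⟨hgt, hz.2⟩
  have harcE : ∀ o ∈ 𝒪, ∀ i u v, IsHalfArc A o.1 o.2 i u v → u ∈ E i ∧ v ∈ E i := by
    intro o ho i u v ha
    have hul := left_mem_Icc.2 ha.lt.le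
    have hvr := right_mem_Icc.2 ha.lt.le
    rcases ha.ends with ⟨h1, h2⟩ | ⟨h1, h2⟩
    · exact ⟨⟨ha.subset hul, .inr ⟨o, ho, h1⟩⟩,
        ha.subset hvr, .inl (hbdry o ho _ (ha.mapsTo_closure hvr) h2)⟩
    · exact ⟨⟨ha.subset hul, .inl (hbdry o ho _ (ha.mapsTo_closure hul) h2)⟩,
        ha.subset hvr, .inr ⟨o, ho, h1⟩⟩
  have htassel := fun o : 𝒪 => (hcell o o.2).exists_tassel G
    (by
      refine (finite_iUnion fun i => ((finite_singleton i).prod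
        ((hE i).prod (hE i)))).subset fun x hx => mem_iUnion.2 ⟨x.1, rfl, ?_⟩
      exact harcE o o.2 _ _ _ hx)
    (by
      obtain ⟨i, t, ht, htp⟩ := ArcSystem.mem_carrier.1 (hbase o o.2).2
      obtain ⟨u, v, htuv, -, o', ho', ha⟩ := hhalf i t ht
      have := huniq o o.2 o' ho' _ (hbase o o.2).1 (htp ▸ (ha.mapsTo_closure htuv).1)
      exact ⟨i, u, v, this ▸ ha⟩)
    (by
      rintro x ⟨hxO, hxA⟩ hxp
      obtain ⟨i, t, ht, rfl⟩ := ArcSystem.mem_carrier.1 hxA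
      have htE : t ∉ E i := fun htE => hxp (hEO i t htE o o.2 hxO)
      obtain ⟨u, v, -, htuv, o', ho', ha⟩ := hhalf i t ht
      have := huniq o o.2 o' ho' _ hxO (subset_closure (ha.mapsTo (htuv htE)).1)
      exact ⟨i, u, v, this ▸ ha, mem_image_of_mem _ (htuv htE)⟩)
    fun x hx hxO => hcut.2 x (hbdry o o.2 x hx hxO)
  choose T hT hTr hTs using htassel
  have hTcl : ∀ o : 𝒪, (T o).range ⊆ closure o.1.1 ∩ A.carrier := by
    refine fun o => iUnion_subset fun k => ?_
    obtain ⟨i, u, v, ha, hr, -⟩ := hTr o k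
    rw [hr]
    exact ha.mapsTo_closure.image_subset
  have : Finite 𝒪 := hfin.to_subtype
  obtain ⟨n, ⟨ε⟩⟩ := Finite.exists_equiv_fin 𝒪
  have hεne : ∀ {α β}, α ≠ β → (ε.symm α).1 ≠ (ε.symm β).1 := fun hne heq =>
    hne (ε.symm.injective (Subtype.ext heq))
  refine ⟨⟨n, fun α => T (ε.symm α), fun α => (ε.symm α).1.2, fun α => hT _, ?_, ?_⟩, ?_⟩
  -- A common point of two tassels lies in neither cell, hence is a leftover nice point and the far
  -- end of both curves. The open half arcs are disjoint because the cells are, so together they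
  -- fill the carrier there.
  · intro α β hαβ k l t ht t' ht' heq
    obtain ⟨i, u, v, ha, hr, hb⟩ := hTr (ε.symm α) k
    obtain ⟨j, u', v', ha', hr', hb'⟩ := hTr (ε.symm β) l
    set o := ε.symm α
    set o' := ε.symm β
    set q := ((T o).curve k).toFun t
    have hqr : q ∈ ((T o).curve k).range := mem_image_of_mem _ ht
    have hqr' : q ∈ ((T o').curve l).range := heq ▸ mem_image_of_mem _ ht'
    have hqcl : q ∈ closure o.1.1 ∩ A.carrier := hTcl o (mem_iUnion.2 ⟨k, hqr⟩)
    have hqcl' : q ∈ closure o'.1.1 ∩ A.carrier := hTcl o' (mem_iUnion.2 ⟨l, hqr'⟩)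
    have hqO : q ∉ o.1.1 := fun hq =>
      hεne hαβ (huniq o.1 o.2 o'.1 o'.2 q hq hqcl'.1)
    have hqO' : q ∉ o'.1.1 := fun hq =>
      hεne hαβ (huniq o'.1 o'.2 o.1 o.2 q hq hqcl.1).symm
    have hqn : A.IsNice q := hcut.2 q (hbdry o.1 o.2 q hqcl hqO)
    refine ⟨.inr (hb t ht hqO), .inr (hb' t' ht' (heq ▸ hqO')), ?_⟩
    have hends : ∀ {o : Set M × M} {i : A.ι} {u v : ℝ}, IsHalfArc A o.1 o.2 i u v →
        q ∈ A.c i '' Icc u v → q ∉ o.1 → A.c i u = q ∨ A.c i v = q := by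
      rintro o i u v ha ⟨w, hw, hwq⟩ hqO
      rcases hw.1.eq_or_lt with rfl | h1
      · exact .inl hwq
      rcases hw.2.eq_or_lt with rfl | h2
      · exact .inr hwq
      · exact absurd (hwq ▸ (ha.mapsTo ⟨h1, h2⟩).1) hqO
    obtain ⟨D, h, s, s', hpc⟩ := (hcell o.1 o.2).pre
    have hev := hqn.eventually_mem_of_disjoint hpc.isHeight (hpc.closure_subset hqcl) hqcl.2
      ha.lt ha.subset (hends ha (hr ▸ hqr) hqO) ha'.lt ha'.subset (hends ha' (hr' ▸ hqr') hqO')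
      ((hpd o.2 o'.2 (hεne hαβ)).mono (fun x hx => (ha.image_subset hx).1)
        fun x hx => (ha'.image_subset hx).1)
    refine (hqn.isLocArc hqcl.2).congr hqcl.2 hev (Subset.antisymm ?_ ?_)
    · rintro x ⟨hx, hxA⟩
      refine ⟨hx, ?_⟩
      rcases hx hxA with hxi | hxj
      · exact .inl (mem_iUnion.2 ⟨k, hr ▸ hxi⟩)
      · exact .inr (mem_iUnion.2 ⟨l, hr' ▸ hxj⟩)
    · rintro x ⟨hx, hxT | hxT⟩
      · exact ⟨hx, (hTcl o hxT).2⟩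
      · exact ⟨hx, (hTcl o' hxT).2⟩
  · intro α β hαβ hmem
    exact hεne hαβ (huniq _ (ε.symm α).2 _ (ε.symm β).2 _ (hbase _ (ε.symm α).2).1
      (hTcl _ hmem).1)
  · intro i
    refine interval_of_consecutive (hE i)
      (P := fun u v => IsProductOf (Web.curves _) (A.c i) u v)
      (fun _ _ _ hxy hyz h h' => IsProductOf.mul hxy hyz h h') ?_
      _ (hend i).1 _ (hend i).2 (A.lt i)
    intro u hu v hv huv hno
    obtain ⟨o, ho, ha⟩ := hcons i u hu v hv huv hno
    obtain ⟨k, hk⟩ := hTs ⟨o, ho⟩ i u v ha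
    have hmem : ∃ α, ∃ l, (T (ε.symm α)).curve l = (T ⟨o, ho⟩).curve k := by
      refine ⟨ε ⟨o, ho⟩, ?_⟩
      rw [ε.symm_apply_apply]
      exact ⟨k, rfl⟩
    exact hk.elim (IsProductOf.curve _ hmem) (IsProductOf.inverse _ hmem)

/-- Every family of curves depends on a web. -/
theorem CurveFamily.exists_web [T2Space M] [IsManifold (𝓡 N) ∞ M] (G : Type*) [Group G]
    (C : CurveFamily N M) : ∃ W : Web G N M, C.DependsOn W.curves := by
  choose n τ hτ ha hb himm using fun k => (C.curve k).piecewise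
  let A : ArcSystem N M :=
    { ι := Σ k, Fin (n k)
      finite := inferInstance
      c := fun x => (C.curve x.1).toFun
      a := fun x => τ x.1 x.2.castSucc
      b := fun x => τ x.1 x.2.succ
      lt := fun x => hτ x.1 x.2.castSucc_lt_succ
      imm := fun x => himm x.1 x.2 }
  obtain ⟨W, hW⟩ := A.exists_web G
  refine ⟨W, fun k => ?_⟩
  -- The smooth pieces are glued from the left; m = 0 is excluded because there is no empty product.
  have key : ∀ m : Fin (n k + 1), m ≠ 0 →
      IsProductOf W.curves (C.curve k).toFun (τ k 0) (τ k m) := by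
    intro m
    induction m using Fin.induction with
    | zero => exact fun h0 => absurd rfl h0
    | succ m ih =>
      intro _
      have hpiece : IsProductOf W.curves (C.curve k).toFun (τ k m.castSucc) (τ k m.succ) :=
        hW ⟨k, m⟩
      by_cases hm : m.castSucc = 0
      · rwa [hm] at hpiece
      · exact IsProductOf.mul (hτ k (Fin.pos_iff_ne_zero.2 hm)) (hτ k m.castSucc_lt_succ)
          (ih hm) hpiece
  rw [← ha k, ← hb k]
  refine key _ fun hlast => ?_
  have := (C.curve k).a_lt_b
  rw [← ha k, ← hb k, hlast] at this
  exact lt_irrefl _ this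

end Webs

end SmoothWebs

theorem proposition1
    {m : ℕ} (G : Type*) [Group G] [TopologicalSpace G] [T2Space G] [CompactSpace G]
    [ConnectedSpace G] [ChartedSpace (EuclideanSpace ℝ (Fin m)) G] [LieGroup (𝓡 m) ∞ G]
    {N : ℕ} {M : Type*} [TopologicalSpace M] [T2Space M] [ParacompactSpace M]
    [ChartedSpace (EuclideanSpace ℝ (Fin N)) M] [IsManifold (𝓡 N) ∞ M]
    (C : SmoothWebs.CurveFamily N M) :
    ∃ W : SmoothWebs.Web G N M, C.DependsOn W.curves := C.exists_web G
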